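/- A metric space $X$ is geodesic if any two points $x,y$ are joined by a geodesic path $[0,d(x,y)]\to X$ parameterized by arclength; a geodesic space is hyperbolic if for some $\delta\ge 0$ each side of every geodesic triangle lies in the $\delta$-neighborhood of the union of the other two sides. With $(x\cdot y)_o=\frac12\big(d(x,o)+d(y,o)-d(x,y)\big)$ for a basepoint $o\in X$, the boundary $\partial X$ of a hyperbolic space $X$ is the set of sequences $\{x^k\}$ in $X$ with $\liminf_{k,l\to\infty}(x^k\cdot x^l)_o=\infty$ (sequences converging to infinity), modulo the equivalence relation $\{x^k\}\sim\{y^k\}$ iff $\liminf_{k,l\to\infty}(x^k\cdot y^l)_o=\infty$. It carries the topology in which a set $S$ is open iff for each $v\in S$ there is $r>0$ with $U(v,r)\subset S$, where $U(v,r)$ is the set of all $w\in\partial X$ such that $v=[\{x^k\}]$ and $w=[\{y^k\}]$ for some sequences with $\liminf_{k,l\to\infty}(x^k\cdot y^l)_o\ge r$. **Theorem.** Let $(X_1,d_1)$ and $(X_2,d_2)$ be proper geodesic hyperbolic metric spaces and let $z_i\in X_i$, $i=1,2$. Let $$Y=\{(x_1,x_2)\in X_1\times X_2 \mid d_1(x_1,z_1)=d_2(x_2,z_2)\},$$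 let $d_e$ be the restriction to $Y$ of the product metric $\big(d_1(x_1,y_1)^2+d_2(x_2,y_2)^2\big)^{1/2}$, and let $d(x,y)$ be the infimum of the $d_e$-lengths of the continuous curves in $(Y,d_e)$ from $x$ to $y$. Then $d$ is a (finite) metric on $Y$ and $(Y,d)$ is a proper geodesic hyperbolic space. Moreover, for all choices of basepoints in $Y$, $X_1$, $X_2$, there is a homeomorphism $\partial Y\to\partial X_1\times\partial X_2$ which is natural in the following sense: if a sequence $\{(x_1^k,x_2^k)\}$ in $Y$ converges to infinity, then so do $\{x_1^k\}$ in $X_1$ and $\{x_2^k\}$ in $X_2$, and the homeomorphism sends $[\{(x_1^k,x_2^k)\}]$ to $([\{x_1^k\}],[\{x_2^k\}])$. -/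

import Mathlib

open Set Filter

noncomputable section

namespace HypProd

/-! ### Geodesic spaces and hyperbolicity -/

/-- `γ`, restricted to `[0, d(x,y)]`, is a geodesic path from `x` to `y` parameterized by
arclength. -/
def IsGeodesicPath {X : Type*} [MetricSpace X] (γ : ℝ → X) (x y : X) : Prop :=
  γ 0 = x ∧ γ (dist x y) = y ∧
    ∀ s ∈ Icc 0 (dist x y), ∀ t ∈ Icc 0 (dist x y), dist (γ s) (γ t) = |s - t|

/-- `S` is a geodesic segment joining `x` to `y`: the image of a geodesic path. -/
def IsGeodesicSegment {X : Type*} [MetricSpace X] (S : Set X) (x y : X) : Prop :=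
  ∃ γ : ℝ → X, IsGeodesicPath γ x y ∧ S = γ '' Icc 0 (dist x y)

/-- A metric space is geodesic if any two points can be joined by a geodesic segment. -/
class GeodesicSpace (X : Type*) [MetricSpace X] : Prop where
  exists_geodesicPath : ∀ x y : X, ∃ γ : ℝ → X, IsGeodesicPath γ x y

/-- `δ`-hyperbolicity: in every triangle with geodesic sides, each side is contained in the
`δ`-neighborhood of the union of the two other sides. -/
def IsDeltaHyperbolic (X : Type*) [MetricSpace X] (δ : ℝ) : Prop :=
  ∀ (x y z : X) (Sxy Syz Sxz : Set X),
    IsGeodesicSegment Sxy x y → IsGeodesicSegment Syz y z → IsGeodesicSegment Sxz x z →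
      (∀ p ∈ Sxy, ∃ q ∈ Syz ∪ Sxz, dist p q ≤ δ) ∧
      (∀ p ∈ Syz, ∃ q ∈ Sxy ∪ Sxz, dist p q ≤ δ) ∧
      (∀ p ∈ Sxz, ∃ q ∈ Sxy ∪ Syz, dist p q ≤ δ)

/-- A space is hyperbolic if it is `δ`-hyperbolic for some `δ ≥ 0`. -/
def IsHyperbolic (X : Type*) [MetricSpace X] : Prop :=
  ∃ δ : ℝ, 0 ≤ δ ∧ IsDeltaHyperbolic X δ

/-! ### The boundary at infinity -/

/-- The Gromov product `(x · y)_o`. -/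
def gromovProduct {X : Type*} [MetricSpace X] (o x y : X) : ℝ :=
  (dist x o + dist y o - dist x y) / 2

/-- `liminf_{k,l → ∞} (x^k · y^l)_o`, as an extended real number. -/
def gromovLiminf {X : Type*} [MetricSpace X] (o : X) (x y : ℕ → X) : EReal :=
  liminf (fun p : ℕ × ℕ => ((gromovProduct o (x p.1) (y p.2) : ℝ) : EReal)) atTop

/-- The sequence `x` converges to infinity. -/
def ConvergesToInfinity {X : Type*} [MetricSpace X] (o : X) (x : ℕ → X) : Prop :=
  gromovLiminf o x x = ⊤

/-- The sequences converging to infinity. -/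
def SeqToInfinity (X : Type*) [MetricSpace X] (o : X) : Type _ :=
  {x : ℕ → X // ConvergesToInfinity o x}

/-- The relation `{x^k} ∼ {y^k}` on sequences converging to infinity. -/
def SeqEquivalent {X : Type*} [MetricSpace X] (o : X) (x y : SeqToInfinity X o) : Prop :=
  gromovLiminf o x.1 y.1 = ⊤

/-- The boundary `∂X`, defined with the basepoint `o`: the quotient of the sequences converging to
infinity by `∼`, which is an equivalence relation when `X` is hyperbolic. -/
def Boundary (X : Type*) [MetricSpace X] (o : X) : Type _ :=
  Quot (SeqEquivalent (X := X) o)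

/-- The point `[{x^k}]` of `∂X`. -/
def Boundary.mk {X : Type*} [MetricSpace X] (o : X) (x : ℕ → X) (hx : ConvergesToInfinity o x) :
    Boundary X o :=
  Quot.mk _ ⟨x, hx⟩

/-- The set `U(v, r)`. -/
def Boundary.basicNhd {X : Type*} [MetricSpace X] {o : X} (v : Boundary X o) (r : ℝ) :
    Set (Boundary X o) :=
  {w | ∃ (x y : ℕ → X) (hx : ConvergesToInfinity o x) (hy : ConvergesToInfinity o y),
    Boundary.mk o x hx = v ∧ Boundary.mk o y hy = w ∧ (r : EReal) ≤ gromovLiminf o x y}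

lemma Boundary.basicNhd_anti {X : Type*} [MetricSpace X] {o : X} (v : Boundary X o) {r s : ℝ}
    (h : r ≤ s) : v.basicNhd s ⊆ v.basicNhd r := by
  rintro w ⟨x, y, hx, hy, h1, h2, h3⟩
  exact ⟨x, y, hx, hy, h1, h2, le_trans (EReal.coe_le_coe_iff.2 h) h3⟩

/-- The topology of `∂X` for which the sets `U(v, r)`, `r > 0`, form the basic neighborhoods of
`v`: a set is open if with each of its points `v` it contains some `U(v, r)`. -/
instance Boundary.instTopologicalSpace {X : Type*} [MetricSpace X] (o : X) :
    TopologicalSpace (Boundary X o) where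
  IsOpen s := ∀ v ∈ s, ∃ r : ℝ, 0 < r ∧ v.basicNhd r ⊆ s
  isOpen_univ := fun _ _ => ⟨1, one_pos, subset_univ _⟩
  isOpen_inter := by
    intro s t hs ht v hv
    obtain ⟨r, hr, h⟩ := hs v hv.1
    obtain ⟨r', _, h'⟩ := ht v hv.2
    exact ⟨max r r', lt_max_of_lt_left hr, subset_inter
      ((v.basicNhd_anti (le_max_left _ _)).trans h)
      ((v.basicNhd_anti (le_max_right _ _)).trans h')⟩
  isOpen_sUnion := by
    intro S hS v hv
    obtain ⟨s, hs, hvs⟩ := hv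
    obtain ⟨r, hr, h⟩ := hS s hs v hvs
    exact ⟨r, hr, h.trans (subset_sUnion_of_mem hs)⟩

/-! ### Length of curves and the interior distance -/

/-- The length of a curve. -/
def curveLength {E : Type*} [MetricSpace E] {x y : E} (c : Path x y) : ENNReal :=
  eVariationOn (c : unitInterval → E) univ

/-- The interior distance: the infimum of the lengths of the curves joining `x` to `y`. -/
def interiorEDist {E : Type*} [MetricSpace E] (x y : E) : ENNReal :=
  ⨅ c : Path x y, curveLength c

lemma edist_le_interiorEDist {E : Type*} [MetricSpace E] (x y : E) :
    edist x y ≤ interiorEDist x y := by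
  refine le_iInf fun c => ?_
  have h := eVariationOn.edist_le (c : unitInterval → E) (mem_univ 0) (mem_univ 1)
  simpa [curveLength] using h

lemma interiorEDist_self {E : Type*} [MetricSpace E] (x : E) : interiorEDist x x = 0 := by
  refine le_antisymm (iInf_le_of_le (Path.refl x) ?_) bot_le
  refine le_of_eq (eVariationOn.constant_on ?_)
  rintro _ ⟨s, _, rfl⟩ _ ⟨t, _, rfl⟩
  rfl

lemma interiorEDist_comm_le {E : Type*} [MetricSpace E] (x y : E) :
    interiorEDist x y ≤ interiorEDist y x := by
  refine le_iInf fun c => iInf_le_of_le c.symm ?_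
  exact eVariationOn.comp_le_of_antitoneOn (c : unitInterval → E) unitInterval.symm
    (fun s _ t _ h => unitInterval.symm_le_symm.2 h) (mapsTo_univ _ _)

lemma interiorEDist_comm {E : Type*} [MetricSpace E] (x y : E) :
    interiorEDist x y = interiorEDist y x :=
  le_antisymm (interiorEDist_comm_le x y) (interiorEDist_comm_le y x)

lemma curveLength_trans_le {E : Type*} [MetricSpace E] {x y z : E} (c : Path x y)
    (c' : Path y z) : curveLength (c.trans c') ≤ curveLength c + curveLength c' := by
  let m : unitInterval := ⟨1 / 2, by norm_num, by norm_num⟩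
  have hu : (univ : Set unitInterval) = Iic m ∪ Ici m := by
    rw [Iic_union_Ici]
  unfold curveLength
  rw [hu, eVariationOn.union _ isGreatest_Iic isLeast_Ici, ← hu]
  refine add_le_add ?_ ?_
  · have h : EqOn (c.trans c' : unitInterval → E)
        ((c : unitInterval → E) ∘ fun t : unitInterval =>
          projIcc (0 : ℝ) 1 zero_le_one (2 * (t : ℝ))) (Iic m) := by
      intro t ht
      have := Path.extend_trans_of_le_half c c' (t := (t : ℝ)) ht
      simpa [Path.extend, IccExtend] using this
    rw [eVariationOn.congr h]
    refine eVariationOn.comp_le_of_monotoneOn _ _ (fun s _ t _ hst => ?_) (mapsTo_univ _ _)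
    have hst' : (s : ℝ) ≤ t := hst
    exact monotone_projIcc _ (by linarith)
  · have h : EqOn (c.trans c' : unitInterval → E)
        ((c' : unitInterval → E) ∘ fun t : unitInterval =>
          projIcc (0 : ℝ) 1 zero_le_one (2 * (t : ℝ) - 1)) (Ici m) := by
      intro t ht
      have := Path.extend_trans_of_half_le c c' (t := (t : ℝ)) ht
      simpa [Path.extend, IccExtend] using this
    rw [eVariationOn.congr h]
    refine eVariationOn.comp_le_of_monotoneOn _ _ (fun s _ t _ hst => ?_) (mapsTo_univ _ _)
    have hst' : (s : ℝ) ≤ t := hst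
    exact monotone_projIcc _ (by linarith)

lemma interiorEDist_triangle {E : Type*} [MetricSpace E] (x y z : E) :
    interiorEDist x z ≤ interiorEDist x y + interiorEDist y z := by
  exact ENNReal.le_iInf_add_iInf fun c c' =>
    iInf_le_of_le (c.trans c') (curveLength_trans_le c c')

/-! ### The hyperbolic product -/

/-- The set of all `(x₁, x₂)` with `d₁(x₁, z₁) = d₂(x₂, z₂)`, as a subset of `X₁ × X₂` with the
product metric `(d₁² + d₂²)^(1/2)`. -/
def equidistantSet {X₁ X₂ : Type*} [MetricSpace X₁] [MetricSpace X₂] (z₁ : X₁) (z₂ : X₂) :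
    Set (WithLp 2 (X₁ × X₂)) :=
  {x | dist x.fst z₁ = dist x.snd z₂}

/-- The hyperbolic product `(X₁, z₁) ×ₕ (X₂, z₂)`: a copy of the set `equidistantSet z₁ z₂`, which
is given the interior metric below. -/
structure HyperbolicProduct {X₁ X₂ : Type*} [MetricSpace X₁] [MetricSpace X₂]
    (z₁ : X₁) (z₂ : X₂) where
  toSubset : equidistantSet z₁ z₂

namespace HyperbolicProduct

variable {X₁ X₂ : Type*} [MetricSpace X₁] [MetricSpace X₂] {z₁ : X₁} {z₂ : X₂}

/-- The first coordinate. -/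
def fst (y : HyperbolicProduct z₁ z₂) : X₁ := y.toSubset.1.fst

/-- The second coordinate. -/
def snd (y : HyperbolicProduct z₁ z₂) : X₂ := y.toSubset.1.snd

end HyperbolicProduct

lemma curveLength_ne_top {E : Type*} [MetricSpace E] {x y : E} (c : Path x y) {K : NNReal}
    (hc : LipschitzWith K (c : unitInterval → E)) : curveLength c ≠ ⊤ := by
  have hL : LipschitzWith K ((c : unitInterval → E) ∘ projIcc (0 : ℝ) 1 zero_le_one) := by
    simpa using hc.comp (LipschitzWith.projIcc (a := (0 : ℝ)) (b := 1) zero_le_one)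
  have hb := hL.locallyBoundedVariationOn univ 0 1 (mem_univ _) (mem_univ _)
  refine ne_top_of_le_ne_top hb ?_
  have h := eVariationOn.comp_le_of_monotoneOn
    ((c : unitInterval → E) ∘ projIcc (0 : ℝ) 1 zero_le_one) (s := univ ∩ Icc 0 1) (t := univ)
    (Subtype.val : unitInterval → ℝ) (fun s _ t _ hst => hst) (fun t _ => ⟨mem_univ _, t.2⟩)
  refine le_trans (le_of_eq (eVariationOn.congr fun t _ => ?_)) h
  simp

/-- Moving along geodesics in both factors joins each point of the set to the pair of
basepoints by a curve of finite length. -/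
lemma interiorEDist_base_ne_top {X₁ X₂ : Type*} [MetricSpace X₁] [MetricSpace X₂]
    [GeodesicSpace X₁] [GeodesicSpace X₂] {z₁ : X₁} {z₂ : X₂}
    (x : equidistantSet z₁ z₂) (b : equidistantSet z₁ z₂)
    (hb : b.1 = WithLp.toLp 2 (z₁, z₂)) : interiorEDist x b ≠ ⊤ := by
  obtain ⟨x, hx⟩ := x
  obtain ⟨b, hb'⟩ := b
  obtain rfl : b = WithLp.toLp 2 (z₁, z₂) := hb
  obtain ⟨γ₁, h10, h11, h12⟩ := GeodesicSpace.exists_geodesicPath x.fst z₁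
  obtain ⟨γ₂, h20, h21, h22⟩ := GeodesicSpace.exists_geodesicPath x.snd z₂
  have hx' : dist x.fst z₁ = dist x.snd z₂ := hx
  rw [← hx'] at h21 h22
  set h : ℝ := dist x.fst z₁ with hh
  have h0 : 0 ≤ h := dist_nonneg
  have hm : ∀ t : unitInterval, h * (t : ℝ) ∈ Icc 0 h := fun t =>
    ⟨mul_nonneg h0 t.2.1, mul_le_of_le_one_right h0 t.2.2⟩
  have hmem : ∀ t : unitInterval,
      WithLp.toLp 2 (γ₁ (h * (t : ℝ)), γ₂ (h * (t : ℝ))) ∈ equidistantSet z₁ z₂ := by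
    intro t
    change dist (γ₁ (h * (t : ℝ))) z₁ = dist (γ₂ (h * (t : ℝ))) z₂
    rw [← h11, ← h21, h12 _ (hm t) _ ⟨h0, le_rfl⟩, h22 _ (hm t) _ ⟨h0, le_rfl⟩]
  let f : unitInterval → equidistantSet z₁ z₂ := fun t => ⟨_, hmem t⟩
  have hf : ∃ K : NNReal, LipschitzWith K f := by
    have hq₁ : LipschitzWith h.toNNReal fun t : unitInterval => γ₁ (h * (t : ℝ)) := by
      refine LipschitzWith.of_dist_le_mul fun s t => ?_
      rw [h12 _ (hm s) _ (hm t), Real.coe_toNNReal _ h0, ← mul_sub, abs_mul, abs_of_nonneg h0]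
      rfl
    have hq₂ : LipschitzWith h.toNNReal fun t : unitInterval => γ₂ (h * (t : ℝ)) := by
      refine LipschitzWith.of_dist_le_mul fun s t => ?_
      rw [h22 _ (hm s) _ (hm t), Real.coe_toNNReal _ h0, ← mul_sub, abs_mul, abs_of_nonneg h0]
      rfl
    have hp := (WithLp.prod_lipschitzWith_toLp 2 X₁ X₂).comp (hq₁.prodMk hq₂)
    exact ⟨_, fun s t => hp s t⟩
  obtain ⟨K, hK⟩ := hf
  let c : Path (⟨x, hx⟩ : equidistantSet z₁ z₂) ⟨WithLp.toLp 2 (z₁, z₂), hb'⟩ :=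
    { toFun := f
      continuous_toFun := hK.continuous
      source' := by
        apply Subtype.ext
        change WithLp.toLp 2 (γ₁ (h * 0), γ₂ (h * 0)) = x
        rw [mul_zero, h10, h20]
        rfl
      target' := by
        apply Subtype.ext
        change WithLp.toLp 2 (γ₁ (h * 1), γ₂ (h * 1)) = _
        rw [mul_one, h11, h21] }
  exact ne_top_of_le_ne_top (curveLength_ne_top c hK) (iInf_le _ c)

lemma interiorEDist_ne_top {X₁ X₂ : Type*} [MetricSpace X₁] [MetricSpace X₂]
    [GeodesicSpace X₁] [GeodesicSpace X₂] {z₁ : X₁} {z₂ : X₂}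
    (x y : equidistantSet z₁ z₂) : interiorEDist x y ≠ ⊤ := by
  let b : equidistantSet z₁ z₂ := ⟨WithLp.toLp 2 (z₁, z₂), by
    change dist z₁ z₁ = dist z₂ z₂
    rw [dist_self, dist_self]⟩
  refine ne_top_of_le_ne_top ?_ (interiorEDist_triangle x b y)
  rw [interiorEDist_comm b y]
  exact ENNReal.add_ne_top.2
    ⟨interiorEDist_base_ne_top x b rfl, interiorEDist_base_ne_top y b rfl⟩

/-- The interior metric of the hyperbolic product: the infimum of the lengths, with respect to the
product metric, of the curves in the set that join two points. -/
instance HyperbolicProduct.instMetricSpace {X₁ X₂ : Type*} [MetricSpace X₁] [MetricSpace X₂]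
    [GeodesicSpace X₁] [GeodesicSpace X₂] (z₁ : X₁) (z₂ : X₂) :
    MetricSpace (HyperbolicProduct z₁ z₂) where
  dist x y := (interiorEDist x.toSubset y.toSubset).toReal
  dist_self x := by rw [interiorEDist_self]; rfl
  dist_comm x y := by rw [interiorEDist_comm]
  dist_triangle x y z := by
    rw [← ENNReal.toReal_add (interiorEDist_ne_top _ _) (interiorEDist_ne_top _ _)]
    exact ENNReal.toReal_mono
      (ENNReal.add_ne_top.2 ⟨interiorEDist_ne_top _ _, interiorEDist_ne_top _ _⟩)
      (interiorEDist_triangle _ _ _)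
  eq_of_dist_eq_zero := by
    intro x y h
    have h0 : interiorEDist x.toSubset y.toSubset = 0 :=
      ((ENNReal.toReal_eq_zero_iff _).1 h).resolve_right (interiorEDist_ne_top _ _)
    have h1 : edist x.toSubset y.toSubset ≤ 0 := h0 ▸ edist_le_interiorEDist _ _
    cases x
    cases y
    congr 1
    exact edist_le_zero.1 h1

end HypProd

end

/-!
Write `|x|` for the common height of a point `x = (x₁, x₂)` of the product `Y`, its distance to
`z₁` or `z₂` in the factors. Vertical curves, which move along geodesics to the basepoints in both
factors at once, have speed `√2`, so that the distance in `Y` from `x` to the pair of basepoints is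
`√2 * |x|`. Everything about the large-scale geometry follows from one estimate, for the Gromov
products at the basepoints: up to an additive constant,
`(x · y) = √2 * min ((x₁ · y₁), (x₂ · y₂))`
(`HyperbolicProduct.exists_abs_gromovProduct_sub_le`).

* Upper bound for the distance: below the height `min ((x₁ · y₁), (x₂ · y₂))` the vertical
  geodesics to `x` and `y` are uniformly close in both factors. Descend a little below this height,
  change the vertical geodesics one factor at a time, and ascend
  (`HyperbolicProduct.dist_le_of_crossing`).
* Lower bound: the length of a curve in `Y` is at least `1 / √2` times the sum of the horizontal and
  vertical length of its projection to a factor. A curve in a hyperbolic space that avoids the ball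
  whose radius exceeds the Gromov product of its endpoints by `t` has excess length exponential in
  `t`, so it does not pay to turn around before reaching the height of the Gromov product
  (`le_gromovProduct_of_chain`, `exists_le_chain_length`).

The four-point condition for Gromov products passes to minima, hence to `Y`, and it is equivalent to
thinness of geodesic triangles (`IsDeltaHyperbolic.fourPoint`, `isDeltaHyperbolic_of_basepoint`).
The estimate also shows that a sequence in `Y` converges to infinity exactly when both of its
coordinate sequences do, and likewise for equivalence of sequences and for the basic neighborhoods
of boundary points. This gives the homeomorphism of boundaries; it is onto because sequences in the
two factors can be lowered along vertical geodesics to the same heights.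

Locally, the crossing construction and compactness of balls in the factors show that the interior
metric induces the topology of the product metric (`HyperbolicProduct.tendsto_of_coords`). So `Y` is
proper, and a limit of nearly shortest curves, reparameterized by the distance to their starting
point, is a geodesic.
-/

noncomputable section

namespace HypProd

/-! ### Gromov products and thin triangles -/

section Gromov

variable {X : Type*} [MetricSpace X]

lemma gromovProduct_comm (o x y : X) : gromovProduct o x y = gromovProduct o y x := by
  unfold gromovProduct
  rw [dist_comm x y]
  ring

lemma gromovProduct_le_left (o x y : X) : gromovProduct o x y ≤ dist x o := by
  unfold gromovProduct
  linarith [dist_triangle_left y o x, dist_comm x y]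

lemma gromovProduct_le_right (o x y : X) : gromovProduct o x y ≤ dist y o := by
  rw [gromovProduct_comm]
  exact gromovProduct_le_left o y x

lemma abs_gromovProduct_sub_le (o o' x y : X) :
    |gromovProduct o x y - gromovProduct o' x y| ≤ dist o o' := by
  unfold gromovProduct
  rw [abs_le]
  constructor <;>
    linarith [dist_triangle x o o', dist_triangle y o o', dist_triangle_right x o o',
      dist_triangle_right y o o', dist_comm o o', dist_triangle x o' o, dist_triangle y o' o]

/-- Gromov's four-point condition, at the basepoint `o`, with defect `δ`. -/
def FourPointAt (o : X) (δ : ℝ) : Prop :=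
  ∀ x y w : X, min (gromovProduct o x w) (gromovProduct o w y) ≤ gromovProduct o x y + δ

/-- Gromov's four-point condition, at all basepoints, with defect `δ`. -/
def FourPoint (X : Type*) [MetricSpace X] (δ : ℝ) : Prop :=
  ∀ o : X, FourPointAt o δ

lemma FourPoint.mono {δ δ' : ℝ} (h : FourPoint X δ) (hδ : δ ≤ δ') : FourPoint X δ' :=
  fun o x y w => (h o x y w).trans (by linarith)

lemma IsGeodesicPath.dist_left {γ : ℝ → X} {x y : X} (h : IsGeodesicPath γ x y) {t : ℝ}
    (ht : t ∈ Icc 0 (dist x y)) : dist x (γ t) = t := by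
  have := h.2.2 0 ⟨le_rfl, dist_nonneg⟩ t ht
  rwa [h.1, zero_sub, abs_neg, abs_of_nonneg ht.1] at this

lemma IsGeodesicPath.dist_right {γ : ℝ → X} {x y : X} (h : IsGeodesicPath γ x y) {t : ℝ}
    (ht : t ∈ Icc 0 (dist x y)) : dist (γ t) y = dist x y - t := by
  have := h.2.2 t ht _ ⟨dist_nonneg, le_rfl⟩
  rwa [h.2.1, abs_sub_comm, abs_of_nonneg (sub_nonneg.2 ht.2)] at this

lemma IsGeodesicSegment.dist_add {S : Set X} {x y p : X} (h : IsGeodesicSegment S x y)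
    (hp : p ∈ S) : dist x p + dist p y = dist x y := by
  obtain ⟨γ, hγ, rfl⟩ := h
  obtain ⟨t, ht, rfl⟩ := hp
  rw [hγ.dist_left ht, hγ.dist_right ht]
  ring

/-- A geodesic segment from `x` to `y` comes as close to `o` as the Gromov product allows, up to
a constant: it is covered by the neighborhoods of the other two sides of a triangle with third
vertex `o`, so it has a point close to both of them. -/
lemma IsDeltaHyperbolic.exists_dist_le_gromovProduct [GeodesicSpace X] {δ : ℝ}
    (h : IsDeltaHyperbolic X δ) (o : X) {x y : X} {S : Set X} (hS : IsGeodesicSegment S x y) :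
    ∃ p ∈ S, dist o p ≤ gromovProduct o x y + (2 * δ + 1) := by
  obtain ⟨γ, hγ, rfl⟩ := hS
  obtain ⟨α, hα⟩ := GeodesicSpace.exists_geodesicPath x o
  obtain ⟨β, hβ⟩ := GeodesicSpace.exists_geodesicPath y o
  have hSα : IsGeodesicSegment (α '' Icc 0 (dist x o)) x o := ⟨α, hα, rfl⟩
  have hSβ : IsGeodesicSegment (β '' Icc 0 (dist y o)) y o := ⟨β, hβ, rfl⟩
  have hthin := (h x y o _ _ _ ⟨γ, hγ, rfl⟩ hSβ hSα).1
  have hδ : 0 ≤ δ := by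
    obtain ⟨q, -, hq⟩ := hthin (γ 0) ⟨0, ⟨le_rfl, dist_nonneg⟩, rfl⟩
    exact dist_nonneg.trans hq
  set L := dist x y with hL
  have hL0 : 0 ≤ L := dist_nonneg
  let A : Set ℝ := {t | t ∈ Icc 0 L ∧ ∃ q ∈ α '' Icc 0 (dist x o), dist (γ t) q ≤ δ}
  have h0A : (0 : ℝ) ∈ A := by
    refine ⟨⟨le_rfl, hL0⟩, x, ⟨0, ⟨le_rfl, dist_nonneg⟩, hα.1⟩, ?_⟩
    rw [hγ.1, dist_self]
    exact hδ
  have hAb : BddAbove A := ⟨L, fun t ht => ht.1.2⟩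
  obtain ⟨t, htA, ht⟩ := exists_lt_of_lt_csSup ⟨0, h0A⟩
    (show sSup A - 1 / 2 < sSup A by linarith)
  have htT : t ≤ sSup A := le_csSup hAb htA
  have hTL : sSup A ≤ L := csSup_le ⟨0, h0A⟩ fun t ht => ht.1.2
  -- a parameter close to `t` whose point is close to the other side
  obtain ⟨s, hs, hst, q₂, hq₂, hsq⟩ : ∃ s ∈ Icc 0 L, |t - s| ≤ 1 ∧
      ∃ q ∈ β '' Icc 0 (dist y o), dist (γ s) q ≤ δ := by
    by_cases hc : sSup A + 1 / 2 ≤ L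
    · refine ⟨sSup A + 1 / 2, ⟨by linarith [htA.1.1], hc⟩, ?_, ?_⟩
      · rw [abs_le]
        constructor <;> linarith
      · obtain ⟨q, hq, hd⟩ := hthin (γ (sSup A + 1 / 2)) ⟨_, ⟨by linarith [htA.1.1], hc⟩, rfl⟩
        rcases hq with hq | hq
        · exact ⟨q, hq, hd⟩
        · have : sSup A + 1 / 2 ∈ A := ⟨⟨by linarith [htA.1.1], hc⟩, q, hq, hd⟩
          linarith [le_csSup hAb this]
    · refine ⟨L, ⟨hL0, le_rfl⟩, ?_, y, ⟨0, ⟨le_rfl, dist_nonneg⟩, hβ.1⟩, ?_⟩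
      · rw [abs_le]
        constructor <;> linarith
      · rw [hγ.2.1, dist_self]
        exact hδ
  obtain ⟨q₁, hq₁, htq⟩ := htA.2
  refine ⟨γ t, ⟨t, htA.1, rfl⟩, ?_⟩
  have e1 := hSα.dist_add hq₁
  have e2 := hSβ.dist_add hq₂
  have e3 := hγ.dist_left htA.1
  have e4 := hγ.dist_right htA.1
  have e5 : dist (γ t) q₂ ≤ δ + 1 := by
    have := hγ.2.2 t htA.1 s hs
    linarith [dist_triangle (γ t) (γ s) q₂]
  unfold gromovProduct
  linarith [dist_triangle x q₁ (γ t), dist_triangle o q₁ (γ t), dist_comm q₁ o,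
    dist_triangle y q₂ (γ t), dist_triangle o q₂ (γ t), dist_comm q₂ o, dist_comm q₁ (γ t),
    dist_comm q₂ (γ t), dist_comm y (γ t)]

lemma IsGeodesicSegment.gromovProduct_le {S : Set X} {x y p : X} (h : IsGeodesicSegment S x y)
    (hp : p ∈ S) (o : X) : gromovProduct o x y ≤ dist o p := by
  have := h.dist_add hp
  unfold gromovProduct
  linarith [dist_triangle x p o, dist_triangle y p o, dist_comm y p, dist_comm o p]

lemma IsDeltaHyperbolic.fourPoint [GeodesicSpace X] {δ : ℝ} (h : IsDeltaHyperbolic X δ) :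
    FourPoint X (3 * δ + 1) := by
  intro o x y w
  obtain ⟨γ, hγ⟩ := GeodesicSpace.exists_geodesicPath x y
  obtain ⟨α, hα⟩ := GeodesicSpace.exists_geodesicPath x w
  obtain ⟨β, hβ⟩ := GeodesicSpace.exists_geodesicPath y w
  have hSγ : IsGeodesicSegment (γ '' Icc 0 (dist x y)) x y := ⟨γ, hγ, rfl⟩
  have hSα : IsGeodesicSegment (α '' Icc 0 (dist x w)) x w := ⟨α, hα, rfl⟩
  have hSβ : IsGeodesicSegment (β '' Icc 0 (dist y w)) y w := ⟨β, hβ, rfl⟩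
  obtain ⟨p, hp, hop⟩ := h.exists_dist_le_gromovProduct o hSγ
  obtain ⟨q, hq, hpq⟩ := (h x y w _ _ _ hSγ hSβ hSα).1 p hp
  have hoq : dist o q ≤ gromovProduct o x y + (3 * δ + 1) := by
    linarith [dist_triangle o p q]
  rcases hq with hq | hq
  · have := hSβ.gromovProduct_le hq o
    rw [gromovProduct_comm] at this
    exact (min_le_right _ _).trans (this.trans hoq)
  · exact (min_le_left _ _).trans ((hSα.gromovProduct_le hq o).trans hoq)

/-- The four-point condition at a single basepoint, in terms of distances only: of the three sums
of opposite sides of a quadrilateral, the two larger ones nearly agree. -/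
lemma dist_add_dist_le_of_basepoint {δ : ℝ} {o : X}
    (h : FourPointAt o δ) (a b c e : X) :
    dist a b + dist c e ≤ max (dist a c + dist b e) (dist a e + dist b c) + 4 * δ := by
  have key : min (gromovProduct o a c + gromovProduct o b e)
      (gromovProduct o a e + gromovProduct o b c) ≤
      gromovProduct o a b + gromovProduct o c e + 2 * δ := by
    have h1 := h a b c
    have h2 := h a b e
    have h3 := h c e a
    have h4 := h c e b
    rw [gromovProduct_comm o c b] at h1
    rw [gromovProduct_comm o e b] at h2
    rw [gromovProduct_comm o c a] at h3
    rw [gromovProduct_comm o c b] at h4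
    rw [min_le_iff] at h1 h2 h3 h4 ⊢
    rcases h1 with h1 | h1 <;> rcases h2 with h2 | h2 <;> rcases h3 with h3 | h3 <;>
      rcases h4 with h4 | h4 <;>
      first
        | (left; linarith)
        | (right; linarith)
        | (rcases le_total (gromovProduct o a c + gromovProduct o b e)
            (gromovProduct o a e + gromovProduct o b c) with hc | hc
           · left; linarith
           · right; linarith)
  unfold gromovProduct at key
  rw [min_le_iff] at key
  rcases key with key | key
  · linarith [le_max_left (dist a c + dist b e) (dist a e + dist b c)]
  · linarith [le_max_right (dist a c + dist b e) (dist a e + dist b c)]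

lemma IsGeodesicSegment.symm {S : Set X} {x y : X} (h : IsGeodesicSegment S x y) :
    IsGeodesicSegment S y x := by
  obtain ⟨γ, ⟨h0, h1, h2⟩, rfl⟩ := h
  have hm : ∀ t ∈ Icc 0 (dist x y), dist x y - t ∈ Icc 0 (dist x y) := fun t ht =>
    ⟨sub_nonneg.2 ht.2, sub_le_self _ ht.1⟩
  refine ⟨fun t => γ (dist x y - t), ⟨?_, ?_, ?_⟩, ?_⟩
  · simpa using h1
  · simpa [dist_comm y x] using h0
  · rw [dist_comm y x]
    intro s hs t ht
    rw [h2 _ (hm s hs) _ (hm t ht), abs_sub_comm]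
    congr 1
    ring
  · rw [dist_comm y x]
    ext p
    constructor
    · rintro ⟨t, ht, rfl⟩
      exact ⟨_, hm t ht, by simp⟩
    · rintro ⟨t, ht, rfl⟩
      exact ⟨_, hm t ht, rfl⟩

/-- The four-point condition at a single basepoint makes geodesic triangles thin. -/
lemma isDeltaHyperbolic_of_basepoint {δ : ℝ} {o : X} (h : FourPointAt o δ) :
    IsDeltaHyperbolic X (6 * δ) := by
  -- a point nearly between `x` and `w` is close to each segment from `x` to `w`, at the place
  -- where the comparison sums of `dist_add_dist_le_of_basepoint` balance
  have side : ∀ (x w p : X) (S : Set X), IsGeodesicSegment S x w →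
      dist x p + dist p w ≤ dist x w + 4 * δ → ∃ q ∈ S, dist p q ≤ 6 * δ := by
    rintro x w p _ ⟨γ, hγ, rfl⟩ hp
    have ht : (dist x p + dist x w - dist p w) / 2 ∈ Icc 0 (dist x w) :=
      ⟨by linarith [dist_triangle p x w, dist_comm p x],
        by linarith [dist_triangle x w p, dist_comm p w]⟩
    refine ⟨_, ⟨_, ht, rfl⟩, ?_⟩
    have h1 := hγ.dist_left ht
    have h2 := hγ.dist_right ht
    set q := γ ((dist x p + dist x w - dist p w) / 2)
    have h3 := dist_add_dist_le_of_basepoint h p q x w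
    have h4 : dist p x + dist q w = dist p w + dist q x := by
      linarith [dist_comm p x, dist_comm q x]
    rw [← h4, max_self] at h3
    linarith [dist_comm p x]
  have main : ∀ (x y w : X) (S T U : Set X), IsGeodesicSegment S x y →
      IsGeodesicSegment T x w → IsGeodesicSegment U y w →
      ∀ p ∈ S, ∃ q ∈ T ∪ U, dist p q ≤ 6 * δ := by
    intro x y w S T U hS hT hU p hp
    have h1 := dist_add_dist_le_of_basepoint h p w x y
    have h2 := hS.dist_add hp
    rcases le_total (dist p x + dist w y) (dist p y + dist w x) with hc | hc
    · rw [max_eq_right hc] at h1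
      obtain ⟨q, hq, hd⟩ := side x w p T hT (by
        linarith [dist_comm p x, dist_comm p y, dist_comm w x, dist_comm w y])
      exact ⟨q, Or.inl hq, hd⟩
    · rw [max_eq_left hc] at h1
      obtain ⟨q, hq, hd⟩ := side y w p U hU (by
        linarith [dist_comm p x, dist_comm p y, dist_comm w x, dist_comm w y])
      exact ⟨q, Or.inr hq, hd⟩
  intro x y z Sxy Syz Sxz hxy hyz hxz
  refine ⟨?_, main _ _ _ _ _ _ hyz hxy.symm hxz.symm, main _ _ _ _ _ _ hxz hxy hyz.symm⟩
  rw [union_comm]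
  exact main _ _ _ _ _ _ hxy hxz hyz

/-! ### Vertical geodesics -/

/-- `σ`, restricted to `[0, d(a,z)]`, is a geodesic path from `z` to `a` parameterized by the
height, that is, by the distance to `z`. -/
structure IsVertical (z a : X) (σ : ℝ → X) : Prop where
  height : ∀ t ∈ Icc 0 (dist a z), dist (σ t) z = t
  apply_dist : σ (dist a z) = a
  dist_le : ∀ s ∈ Icc 0 (dist a z), ∀ t ∈ Icc 0 (dist a z), dist (σ s) (σ t) ≤ |s - t|

lemma exists_isVertical [GeodesicSpace X] (z a : X) : ∃ σ, IsVertical z a σ := by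
  obtain ⟨σ, h⟩ := GeodesicSpace.exists_geodesicPath z a
  refine ⟨σ, ?_, ?_, ?_⟩ <;> rw [dist_comm a z]
  · intro t ht
    rw [dist_comm]
    exact h.dist_left ht
  · exact h.2.1
  · exact fun s hs t ht => (h.2.2 s hs t ht).le

lemma IsVertical.dist_apply_self {z a : X} {σ : ℝ → X} (h : IsVertical z a σ) {t : ℝ}
    (ht : t ∈ Icc 0 (dist a z)) : dist (σ t) a = dist a z - t := by
  have h1 := h.dist_le t ht _ ⟨dist_nonneg, le_rfl⟩
  rw [h.apply_dist, abs_sub_comm, abs_of_nonneg (sub_nonneg.2 ht.2)] at h1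
  linarith [dist_triangle_left a z (σ t), h.height t ht, dist_comm (σ t) a]

/-- A point between `z` and `a` lies on a vertical geodesic from `z` to `a`: concatenate. -/
lemma exists_isVertical_through [GeodesicSpace X] {z a p : X}
    (hp : dist a p + dist p z = dist a z) : ∃ σ, IsVertical z a σ ∧ σ (dist p z) = p := by
  obtain ⟨α, hα⟩ := exists_isVertical z p
  obtain ⟨β, hβ⟩ := GeodesicSpace.exists_geodesicPath p a
  have hpa : dist p a = dist a z - dist p z := by linarith [dist_comm a p]
  set h := dist p z with hh
  have h0 : 0 ≤ h := dist_nonneg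
  have hpz : h ≤ dist a z := by linarith [dist_nonneg (x := a) (y := p)]
  let σ : ℝ → X := fun t => if t ≤ h then α t else β (t - h)
  have hσ1 : ∀ t, t ≤ h → σ t = α t := fun t ht => if_pos ht
  have hσ2 : ∀ t, h < t → σ t = β (t - h) := fun t ht => if_neg ht.not_ge
  have hαh : α h = p := hα.apply_dist
  have hm : ∀ t, h < t → t ≤ dist a z → t - h ∈ Icc 0 (dist p a) := fun t h1 h2 =>
    ⟨by linarith, by linarith⟩
  have hlip : ∀ s ∈ Icc 0 (dist a z), ∀ t ∈ Icc 0 (dist a z), s ≤ t →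
      dist (σ s) (σ t) ≤ t - s := by
    intro s hs t ht hst
    rcases le_or_gt t h with h1 | h1
    · rw [hσ1 t h1, hσ1 s (hst.trans h1)]
      have := hα.dist_le s ⟨hs.1, hst.trans h1⟩ t ⟨ht.1, h1⟩
      rwa [abs_sub_comm, abs_of_nonneg (sub_nonneg.2 hst)] at this
    · rw [hσ2 t h1]
      have e2 := hβ.dist_left (hm t h1 ht.2)
      rcases le_or_gt s h with h2 | h2
      · rw [hσ1 s h2]
        have e1 := hα.dist_apply_self ⟨hs.1, h2⟩
        linarith [dist_triangle (α s) p (β (t - h))]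
      · rw [hσ2 s h2, hβ.2.2 _ (hm s h2 hs.2) _ (hm t h1 ht.2), abs_sub_comm,
          abs_of_nonneg (by linarith)]
        linarith
  have hσa : σ (dist a z) = a := by
    rcases hpz.eq_or_lt with h1 | h1
    · have : dist a p = 0 := by linarith [dist_comm a p]
      rw [hσ1 _ h1.ge, ← h1, hαh, dist_eq_zero.1 this]
    · rw [hσ2 _ h1, ← hpa, hβ.2.1]
  refine ⟨σ, ⟨fun t ht => ?_, hσa, fun s hs t ht => ?_⟩, by rw [hσ1 _ le_rfl, hαh]⟩
  · rcases le_or_gt t h with h1 | h1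
    · rw [hσ1 t h1]
      exact hα.height t ⟨ht.1, h1⟩
    · have e1 := hlip t ht _ ⟨dist_nonneg, le_rfl⟩ ht.2
      rw [hσa] at e1
      have e2 := hβ.dist_left (hm t h1 ht.2)
      rw [← hσ2 t h1] at e2
      linarith [dist_triangle_left a z (σ t), dist_triangle_left (σ t) z p,
        dist_comm (σ t) a]
  · rcases le_total s t with hst | hst
    · rw [abs_sub_comm, abs_of_nonneg (sub_nonneg.2 hst)]
      exact hlip s hs t ht hst
    · rw [dist_comm, abs_of_nonneg (sub_nonneg.2 hst)]
      exact hlip t ht s hs hst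

lemma IsVertical.gromovProduct_eq {z a : X} {σ : ℝ → X} (h : IsVertical z a σ) {t : ℝ}
    (ht : t ∈ Icc 0 (dist a z)) : gromovProduct z (σ t) a = t := by
  unfold gromovProduct
  rw [h.height t ht, h.dist_apply_self ht]
  ring

/-- Moving `b` down a vertical geodesic to height `t` cuts off the Gromov product with any point
at `t`, up to a constant. -/
lemma IsVertical.min_le_gromovProduct {δ : ℝ} (hX : FourPoint X δ) {z b : X} {τ : ℝ → X}
    (hb : IsVertical z b τ) {t : ℝ} (ht : t ∈ Icc 0 (dist b z)) (a : X) :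
    min (gromovProduct z a b) t ≤ gromovProduct z a (τ t) + δ := by
  have := hX z a (τ t) b
  rwa [gromovProduct_comm z b, hb.gromovProduct_eq ht] at this

/-- Vertical geodesics to `a` and `b` stay close up to the height `(a · b)_z`. -/
lemma IsVertical.dist_le_of_le_gromovProduct {δ : ℝ} (hX : FourPoint X δ) (hδ : 0 ≤ δ)
    {z a b : X} {σ τ : ℝ → X} (ha : IsVertical z a σ) (hb : IsVertical z b τ) {t : ℝ}
    (ht0 : 0 ≤ t) (ht : t ≤ gromovProduct z a b) : dist (σ t) (τ t) ≤ 4 * δ := by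
  have hta : t ∈ Icc 0 (dist a z) := ⟨ht0, ht.trans (gromovProduct_le_left _ _ _)⟩
  have htb : t ∈ Icc 0 (dist b z) := ⟨ht0, ht.trans (gromovProduct_le_right _ _ _)⟩
  have h1 := hb.min_le_gromovProduct hX htb a
  have h2 := ha.min_le_gromovProduct hX hta (τ t)
  rw [min_eq_right ht, gromovProduct_comm] at h1
  have h3 : t ≤ gromovProduct z (τ t) (σ t) + 2 * δ := by
    rcases min_le_iff.1 h2 with h | h <;> linarith
  unfold gromovProduct at h3
  rw [ha.height t hta, hb.height t htb, dist_comm] at h3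
  linarith

/-! ### Chains far from the basepoint -/

/-- A chain with steps of length at most one that stays at height at least `m` and has
excess length at most `2 ^ k` over a descent to height `m` and an ascent has endpoints whose Gromov
product is nearly `m`, up to a multiple of `k`: cut the chain where the excess reaches half of its
bound. -/
lemma le_gromovProduct_of_chain {δ : ℝ} (hX : FourPoint X δ) (hδ : 0 ≤ δ) (z : X) (p : ℕ → X)
    (m : ℝ) (N : ℕ) (hm : ∀ i ≤ N, m ≤ dist (p i) z) (hstep : ∀ i < N, dist (p i) (p (i + 1)) ≤ 1)
    (k : ℕ) : ∀ i j, i ≤ j → j ≤ N →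
      ∑ l ∈ Finset.Ico i j, dist (p l) (p (l + 1)) - dist (p i) z - dist (p j) z + 2 * m ≤ 2 ^ k →
      m - 1 / 2 - 2 * k * δ ≤ gromovProduct z (p i) (p j) := by
  induction k with
  | zero =>
    intro i j hij hj he
    have := dist_le_Ico_sum_dist p hij
    unfold gromovProduct
    norm_num at he ⊢
    linarith
  | succ k ih =>
    intro i j hij hj he
    let e : ℕ → ℕ → ℝ := fun i j =>
      ∑ l ∈ Finset.Ico i j, dist (p l) (p (l + 1)) - dist (p i) z - dist (p j) z + 2 * m
    have hk : ((k + 1 : ℕ) : ℝ) = k + 1 := by push_cast; ring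
    rw [hk]
    have hpow : (2 : ℝ) ^ (k + 1) = 2 * 2 ^ k := by ring
    rw [hpow] at he
    by_cases hc : e i j ≤ 2 ^ k
    · have := ih i j hij hj hc
      linarith
    · obtain ⟨t, hit, htj, h1, h2⟩ : ∃ t, i ≤ t ∧ t < j ∧ e i t ≤ 2 ^ k ∧ 2 ^ k < e i (t + 1) := by
        by_contra! hcon
        have hall : ∀ t, i ≤ t → t ≤ j → e i t ≤ 2 ^ k := by
          intro t hit
          induction t, hit using Nat.le_induction with
          | base =>
            intro hij
            have h1 : e i i ≤ 0 := by
              simp only [e, Finset.Ico_self, Finset.sum_empty]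
              linarith [hm i (hij.trans hj)]
            exact h1.trans (by positivity)
          | succ t hit IH =>
            intro htj
            exact hcon t hit htj (IH (by omega))
        exact hc (hall j hij le_rfl)
      have hsum := Finset.sum_Ico_consecutive (fun l => dist (p l) (p (l + 1)))
        (show i ≤ t + 1 by omega) (show t + 1 ≤ j by omega)
      have hmt := hm (t + 1) (by omega)
      have hmt' := hm t (by omega)
      have h3 : e (t + 1) j ≤ 2 ^ k := by
        simp only [e] at h2 ⊢
        linarith
      have g1 := ih i t hit (by omega) h1
      have g2 := ih (t + 1) j (by omega) hj h3
      have g3 : m - 1 / 2 ≤ gromovProduct z (p t) (p (t + 1)) := by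
        unfold gromovProduct
        linarith [hstep t (by omega)]
      have hkδ : 0 ≤ 2 * k * δ := by positivity
      have g4 : m - 1 / 2 - 2 * k * δ ≤ gromovProduct z (p i) (p (t + 1)) + δ :=
        (le_min g1 (by linarith)).trans (hX z (p i) (p (t + 1)) (p t))
      have g5 : m - 1 / 2 - 2 * k * δ - δ ≤ gromovProduct z (p i) (p j) + δ :=
        (le_min (by linarith) (by linarith)).trans (hX z (p i) (p j) (p (t + 1)))
      linarith

lemma exists_mul_le_two_pow_add (A : ℝ) : ∃ C : ℝ, ∀ k : ℕ, A * k ≤ 2 ^ k + C := by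
  have hsq : ∀ k : ℕ, k ^ 2 ≤ 4 * 2 ^ k := by
    intro k
    induction k with
    | zero => norm_num
    | succ k ih =>
      rcases lt_or_ge k 3 with hk | hk
      · interval_cases k <;> norm_num
      · rw [pow_succ 2 k]
        nlinarith
  refine ⟨A ^ 2, fun k => ?_⟩
  have h : (k : ℝ) ^ 2 ≤ 4 * 2 ^ k := by exact_mod_cast hsq k
  nlinarith [sq_nonneg (A - k / 2)]

/-- Up to a constant, a chain with small steps has horizontal plus vertical length at least that of
the broken path which descends to the height of the Gromov product of its endpoints and ascends
again. A chain that turns around at height `m` far above the Gromov product saves only a multiple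
of the difference in vertical length, and by `le_gromovProduct_of_chain` its excess length is
exponential in that difference. -/
lemma exists_le_chain_length {δ : ℝ} (hX : FourPoint X δ) (hδ : 0 ≤ δ) :
    ∃ C : ℝ, ∀ (z : X) (p : ℕ → X) (N : ℕ), (∀ i < N, dist (p i) (p (i + 1)) ≤ 1) →
      2 * (dist (p 0) z + dist (p N) z - 2 * gromovProduct z (p 0) (p N)) - C ≤
        ∑ i ∈ Finset.range N,
          (dist (p i) (p (i + 1)) + |dist (p i) z - dist (p (i + 1)) z|) := by
  obtain ⟨C, hC⟩ := exists_mul_le_two_pow_add (8 * δ)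
  have hC0 : 0 ≤ 1 + C := by simpa using hC 0
  refine ⟨3 + 8 * δ + C, fun z p N hstep => ?_⟩
  obtain ⟨j, hj, hmin⟩ := Finset.exists_min_image (Finset.range (N + 1)) (fun i => dist (p i) z)
    ⟨0, by simp⟩
  have hjN : j ≤ N := by simpa [Nat.lt_succ_iff] using hj
  set m := dist (p j) z with hmdef
  have hm : ∀ i ≤ N, m ≤ dist (p i) z := fun i hi => hmin i (by simpa [Nat.lt_succ_iff] using hi)
  rw [Finset.sum_add_distrib]
  have hV : dist (p 0) z + dist (p N) z - 2 * m ≤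
      ∑ i ∈ Finset.range N, |dist (p i) z - dist (p (i + 1)) z| := by
    rw [← Finset.sum_range_add_sum_Ico _ hjN]
    have h1 := dist_le_range_sum_dist (fun i => dist (p i) z) j
    have h2 := dist_le_Ico_sum_dist (fun i => dist (p i) z) hjN
    simp only [Real.dist_eq] at h1 h2
    linarith [le_abs_self (dist (p 0) z - dist (p j) z), neg_le_abs (dist (p j) z - dist (p N) z)]
  have hS : dist (p 0) z + dist (p N) z - 2 * m ≤
      ∑ i ∈ Finset.range N, dist (p i) (p (i + 1)) := by
    rw [← Finset.sum_range_add_sum_Ico _ hjN]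
    have h1 := dist_le_range_sum_dist p j
    have h2 := dist_le_Ico_sum_dist p hjN
    linarith [dist_triangle (p 0) (p j) z, dist_triangle_left (p N) z (p j)]
  set S := ∑ i ∈ Finset.range N, dist (p i) (p (i + 1)) with hSdef
  have key : ∀ k : ℕ, S - dist (p 0) z - dist (p N) z + 2 * m ≤ 2 ^ k →
      m - 1 / 2 - 2 * k * δ ≤ gromovProduct z (p 0) (p N) := by
    intro k hk
    refine le_gromovProduct_of_chain hX hδ z p m N hm hstep k 0 N (Nat.zero_le _) le_rfl ?_
    rwa [Nat.Ico_zero_eq_range]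
  rcases lt_or_ge (S - dist (p 0) z - dist (p N) z + 2 * m) 1 with he | he
  · have := key 0 (by simpa using he.le)
    simp only [Nat.cast_zero] at this
    linarith
  · obtain ⟨n, hn1, hn2⟩ := exists_nat_pow_near he one_lt_two
    have := key (n + 1) hn2.le
    push_cast at this
    linarith [hC n]

end Gromov

/-! ### Curves and their lengths -/

/-- A curve of finite length can be subdivided into a chain with steps of length at most one, whose
total length is at most that of the curve. -/
lemma exists_chain_of_path {E : Type*} [MetricSpace E] {x y : E} (c : Path x y)
    (hc : curveLength c ≠ ⊤) :
    ∃ (N : ℕ) (p : ℕ → E), p 0 = x ∧ p N = y ∧ (∀ i, dist (p i) (p (i + 1)) ≤ 1) ∧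
      ∑ i ∈ Finset.range N, dist (p i) (p (i + 1)) ≤ (curveLength c).toReal := by
  have hu : UniformContinuous c := CompactSpace.uniformContinuous_of_continuous c.continuous
  obtain ⟨η, hη, h⟩ := Metric.uniformContinuous_iff.1 hu 1 one_pos
  obtain ⟨n, hn⟩ := exists_nat_one_div_lt hη
  have hn0 : (0 : ℝ) < n + 1 := by positivity
  let u : ℕ → unitInterval := fun i => projIcc (0 : ℝ) 1 zero_le_one (i / (n + 1))
  have humono : Monotone u := fun i j hij => monotone_projIcc _ (by gcongr)
  refine ⟨n + 1, fun i => c (u i), ?_, ?_, fun i => ?_, ?_⟩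
  · have : u 0 = 0 := by simp [u]
    simp [this]
  · have : u (n + 1) = 1 := by
      simp only [u]
      push_cast
      rw [div_self hn0.ne']
      exact projIcc_right _
    simp [this]
  · refine (h ?_).le
    have h1 := (LipschitzWith.projIcc (zero_le_one' ℝ)).dist_le_mul
      ((i : ℝ) / (n + 1)) (((i + 1 : ℕ) : ℝ) / (n + 1))
    refine lt_of_le_of_lt h1 (lt_of_le_of_lt (le_of_eq ?_) hn)
    rw [NNReal.coe_one, one_mul, Real.dist_eq, abs_sub_comm, ← sub_div]
    push_cast
    rw [add_sub_cancel_left, abs_of_pos (by positivity)]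
  · have h1 := eVariationOn.sum_le (f := (c : unitInterval → E)) (s := univ) (n := n + 1) humono
      (fun _ => mem_univ _)
    rw [← ENNReal.ofReal_le_iff_le_toReal hc, ENNReal.ofReal_sum_of_nonneg fun _ _ => dist_nonneg]
    refine le_trans (le_of_eq (Finset.sum_congr rfl fun i _ => ?_)) h1
    rw [← edist_dist, edist_comm]

lemma curveLength_le_of_lipschitzWith {E : Type*} [MetricSpace E] {x y : E} (c : Path x y)
    {K : NNReal} (hc : LipschitzWith K (c : unitInterval → E)) : curveLength c ≤ K := by
  have h1 := (hc.lipschitzOnWith (s := univ)).comp_eVariationOn_le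
    (g := (id : unitInterval → unitInterval)) (s := univ) (mapsTo_univ _ _)
  have h2 : eVariationOn (id : unitInterval → unitInterval) univ ≤ 1 := by
    have h3 := (MonotoneOn.eVariationOn_eq (f := (Subtype.val : unitInterval → ℝ))
      (fun s _ t _ hst => hst) (mem_univ 0) (mem_univ 1)).le
    have h4 : (univ : Set unitInterval) ∩ Icc 0 1 = univ := by
      ext t
      simp [unitInterval.le_one']
    have h5 : eVariationOn (Subtype.val : unitInterval → ℝ) univ ≤ 1 := by
      simpa [h4] using h3
    exact h5
  calc curveLength c ≤ K * eVariationOn (id : unitInterval → unitInterval) univ := h1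
    _ ≤ K * 1 := by gcongr
    _ = K := mul_one _

namespace HyperbolicProduct

/-! ### The interior metric of the product -/

variable {X₁ X₂ : Type*} [MetricSpace X₁] [MetricSpace X₂] {z₁ : X₁} {z₂ : X₂}

/-- The common distance of the two coordinates to the basepoints. -/
def height (y : HyperbolicProduct z₁ z₂) : ℝ := dist y.fst z₁

lemma dist_fst (y : HyperbolicProduct z₁ z₂) : dist y.fst z₁ = y.height := rfl

lemma dist_snd (y : HyperbolicProduct z₁ z₂) : dist y.snd z₂ = y.height := y.toSubset.2.symm

lemma height_nonneg (y : HyperbolicProduct z₁ z₂) : 0 ≤ y.height := dist_nonneg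

/-- The point of the hyperbolic product with given coordinates. -/
def ofCoords (x₁ : X₁) (x₂ : X₂) (h : dist x₁ z₁ = dist x₂ z₂) : HyperbolicProduct z₁ z₂ :=
  ⟨⟨WithLp.toLp 2 (x₁, x₂), h⟩⟩

@[simp] lemma ofCoords_fst (x₁ : X₁) (x₂ : X₂) (h : dist x₁ z₁ = dist x₂ z₂) :
    (ofCoords x₁ x₂ h).fst = x₁ := rfl

@[simp] lemma ofCoords_snd (x₁ : X₁) (x₂ : X₂) (h : dist x₁ z₁ = dist x₂ z₂) :
    (ofCoords x₁ x₂ h).snd = x₂ := rfl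

lemma ext_coords {x y : HyperbolicProduct z₁ z₂} (h₁ : x.fst = y.fst) (h₂ : x.snd = y.snd) :
    x = y := by
  obtain ⟨⟨⟨x₁, x₂⟩, hx⟩⟩ := x
  obtain ⟨⟨⟨y₁, y₂⟩, hy⟩⟩ := y
  obtain rfl : x₁ = y₁ := h₁
  obtain rfl : x₂ = y₂ := h₂
  rfl

lemma dist_toSubset (x y : equidistantSet z₁ z₂) :
    dist x y = √(dist x.1.fst y.1.fst ^ 2 + dist x.1.snd y.1.snd ^ 2) := by
  have := WithLp.prod_dist_eq_add (p := 2) (by norm_num) x.1 y.1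
  rw [Subtype.dist_eq, this, Real.sqrt_eq_rpow]
  norm_num

lemma dist_toSubset_le {x y : equidistantSet z₁ z₂} {r : ℝ} (h₁ : dist x.1.fst y.1.fst ≤ r)
    (h₂ : dist x.1.snd y.1.snd ≤ r) : dist x y ≤ √2 * r := by
  have hr : 0 ≤ r := dist_nonneg.trans h₁
  rw [dist_toSubset, Real.sqrt_le_left (by positivity), mul_pow, Real.sq_sqrt zero_le_two]
  have e1 := pow_le_pow_left₀ dist_nonneg h₁ 2
  have e2 := pow_le_pow_left₀ dist_nonneg h₂ 2
  linarith

/-- The vertical displacement is bounded by the displacements in each of the factors. -/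
lemma add_abs_le_dist_toSubset (x y : equidistantSet z₁ z₂) :
    dist x.1.fst y.1.fst + |dist x.1.fst z₁ - dist y.1.fst z₁| ≤ √2 * dist x y ∧
    dist x.1.snd y.1.snd + |dist x.1.snd z₂ - dist y.1.snd z₂| ≤ √2 * dist x y := by
  have hx : dist x.1.fst z₁ = dist x.1.snd z₂ := x.2
  have hy : dist y.1.fst z₁ = dist y.1.snd z₂ := y.2
  have h1 := abs_dist_sub_le x.1.fst y.1.fst z₁
  have h2 := abs_dist_sub_le x.1.snd y.1.snd z₂
  rw [← hx, ← hy] at h2 ⊢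
  rw [dist_toSubset, ← Real.sqrt_mul zero_le_two]
  set a := dist x.1.fst y.1.fst
  set b := dist x.1.snd y.1.snd
  set v := |dist x.1.fst z₁ - dist y.1.fst z₁|
  have hv : 0 ≤ v := abs_nonneg _
  constructor <;> refine Real.le_sqrt_of_sq_le ?_ <;>
    nlinarith [sq_nonneg (a - v), sq_nonneg (b - v), pow_le_pow_left₀ hv h1 2,
      pow_le_pow_left₀ hv h2 2]

variable [GeodesicSpace X₁] [GeodesicSpace X₂]

lemma dist_eq (x y : HyperbolicProduct z₁ z₂) :
    dist x y = (interiorEDist x.toSubset y.toSubset).toReal := rfl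

lemma dist_toSubset_le_dist (x y : HyperbolicProduct z₁ z₂) :
    dist x.toSubset y.toSubset ≤ dist x y := by
  rw [dist_eq, dist_edist]
  exact ENNReal.toReal_mono (interiorEDist_ne_top _ _) (edist_le_interiorEDist _ _)

lemma dist_fst_le (x y : HyperbolicProduct z₁ z₂) : dist x.fst y.fst ≤ dist x y := by
  refine le_trans ?_ (dist_toSubset_le_dist x y)
  rw [dist_toSubset]
  exact Real.le_sqrt_of_sq_le (le_add_of_nonneg_right (sq_nonneg _))

lemma dist_snd_le (x y : HyperbolicProduct z₁ z₂) : dist x.snd y.snd ≤ dist x y := by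
  refine le_trans ?_ (dist_toSubset_le_dist x y)
  rw [dist_toSubset]
  exact Real.le_sqrt_of_sq_le (le_add_of_nonneg_left (sq_nonneg _))

lemma dist_le_curveLength {x y : HyperbolicProduct z₁ z₂} (c : Path x.toSubset y.toSubset)
    (hc : curveLength c ≠ ⊤) : dist x y ≤ (curveLength c).toReal :=
  ENNReal.toReal_mono hc (iInf_le _ c)

lemma exists_curveLength_le (x y : HyperbolicProduct z₁ z₂) {ε : ℝ} (hε : 0 < ε) :
    ∃ c : Path x.toSubset y.toSubset, curveLength c ≠ ⊤ ∧
      (curveLength c).toReal ≤ dist x y + ε := by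
  have h := interiorEDist_ne_top x.toSubset y.toSubset
  obtain ⟨c, hc⟩ := iInf_lt_iff.1 (ENNReal.lt_add_right h (ENNReal.ofReal_pos.2 hε).ne')
  refine ⟨c, hc.ne_top, ?_⟩
  have := ENNReal.toReal_mono (ENNReal.add_ne_top.2 ⟨h, ENNReal.ofReal_ne_top⟩) hc.le
  rwa [ENNReal.toReal_add h ENNReal.ofReal_ne_top, ENNReal.toReal_ofReal hε.le] at this

/-- A pair of curves of speed at most one in the factors, at equal heights, is a curve of speed at
most `√2` in the product. -/
lemma dist_le_of_lipschitz {L : ℝ} (hL : 0 ≤ L) (c₁ : ℝ → X₁) (c₂ : ℝ → X₂)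
    (h₁ : ∀ s ∈ Icc 0 L, ∀ t ∈ Icc 0 L, dist (c₁ s) (c₁ t) ≤ |s - t|)
    (h₂ : ∀ s ∈ Icc 0 L, ∀ t ∈ Icc 0 L, dist (c₂ s) (c₂ t) ≤ |s - t|)
    (h : ∀ t ∈ Icc 0 L, dist (c₁ t) z₁ = dist (c₂ t) z₂) {x y : HyperbolicProduct z₁ z₂}
    (hx₁ : c₁ 0 = x.fst) (hx₂ : c₂ 0 = x.snd) (hy₁ : c₁ L = y.fst) (hy₂ : c₂ L = y.snd) :
    dist x y ≤ √2 * L := by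
  have hm : ∀ t : unitInterval, L * (t : ℝ) ∈ Icc 0 L := fun t =>
    ⟨mul_nonneg hL t.2.1, mul_le_of_le_one_right hL t.2.2⟩
  let f : unitInterval → HyperbolicProduct z₁ z₂ := fun t => ofCoords _ _ (h _ (hm t))
  have hf : LipschitzWith (√2 * L).toNNReal fun t => (f t).toSubset := by
    refine LipschitzWith.of_dist_le_mul fun s t => ?_
    rw [Real.coe_toNNReal _ (by positivity), mul_assoc]
    have e : |L * (s : ℝ) - L * t| = L * dist s t := by
      rw [← mul_sub, abs_mul, abs_of_nonneg hL]
      rfl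
    exact dist_toSubset_le ((h₁ _ (hm s) _ (hm t)).trans e.le) ((h₂ _ (hm s) _ (hm t)).trans e.le)
  let c : Path x.toSubset y.toSubset :=
    { toFun := fun t => (f t).toSubset
      continuous_toFun := hf.continuous
      source' := by
        congr 1
        exact ext_coords (by simp [f, hx₁]) (by simp [f, hx₂])
      target' := by
        congr 1
        exact ext_coords (by simp [f, hy₁]) (by simp [f, hy₂]) }
  have hlen := curveLength_le_of_lipschitzWith c hf
  refine (dist_le_curveLength c (ne_top_of_le_ne_top ENNReal.coe_ne_top hlen)).trans ?_
  have := ENNReal.toReal_mono ENNReal.coe_ne_top hlen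
  rwa [ENNReal.coe_toReal, Real.coe_toNNReal _ (by positivity)] at this

/-- The point at height `t` on a pair of vertical geodesics. -/
def ofVertical {a : HyperbolicProduct z₁ z₂} {σ₁ : ℝ → X₁} {σ₂ : ℝ → X₂}
    (h₁ : IsVertical z₁ a.fst σ₁) (h₂ : IsVertical z₂ a.snd σ₂) (t : ℝ)
    (ht : t ∈ Icc 0 a.height) : HyperbolicProduct z₁ z₂ :=
  ofCoords (σ₁ t) (σ₂ t) (by
    rw [h₁.height t ht, h₂.height t (by rwa [dist_snd])])

lemma dist_ofVertical_le {a : HyperbolicProduct z₁ z₂} {σ₁ : ℝ → X₁} {σ₂ : ℝ → X₂}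
    (h₁ : IsVertical z₁ a.fst σ₁) (h₂ : IsVertical z₂ a.snd σ₂) (t : ℝ)
    (ht : t ∈ Icc 0 a.height) : dist (ofVertical h₁ h₂ t ht) a ≤ √2 * (a.height - t) := by
  have hm : ∀ s ∈ Icc 0 (a.height - t), t + s ∈ Icc 0 a.height := fun s hs =>
    ⟨add_nonneg ht.1 hs.1, by linarith [hs.2]⟩
  have hm' : ∀ s ∈ Icc 0 (a.height - t), t + s ∈ Icc 0 (dist a.snd z₂) := by
    rwa [dist_snd]
  refine dist_le_of_lipschitz (sub_nonneg.2 ht.2) (fun s => σ₁ (t + s)) (fun s => σ₂ (t + s))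
    ?_ ?_ ?_ ?_ ?_ ?_ ?_
  · intro s hs r hr
    simpa using h₁.dist_le _ (hm s hs) _ (hm r hr)
  · intro s hs r hr
    simpa using h₂.dist_le _ (hm' s hs) _ (hm' r hr)
  · intro s hs
    rw [h₁.height _ (hm s hs), h₂.height _ (hm' s hs)]
  · simp [ofVertical]
  · simp [ofVertical]
  · have := h₁.apply_dist
    rw [dist_fst] at this
    simpa using this
  · have := h₂.apply_dist
    rw [dist_snd] at this
    simpa using this

/-- Moving along a geodesic in the first factor, while the second coordinate adjusts its
height along a vertical geodesic. -/
lemma dist_le_of_snd_vertical {a : X₂} {σ : ℝ → X₂} (hσ : IsVertical z₂ a σ)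
    {x y : HyperbolicProduct z₁ z₂} (hx : x.snd = σ x.height) (hy : y.snd = σ y.height)
    (hxa : x.height + dist x.fst y.fst ≤ dist a z₂) : dist x y ≤ √2 * dist x.fst y.fst := by
  obtain ⟨γ, hγ⟩ := GeodesicSpace.exists_geodesicPath x.fst y.fst
  have hm : ∀ t ∈ Icc 0 (dist x.fst y.fst), dist (γ t) z₁ ∈ Icc 0 (dist a z₂) := by
    intro t ht
    refine ⟨dist_nonneg, ?_⟩
    have := hγ.dist_left ht
    linarith [dist_triangle_left (γ t) z₁ x.fst, ht.2, dist_fst x]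
  refine dist_le_of_lipschitz dist_nonneg γ (fun t => σ (dist (γ t) z₁)) ?_ ?_ ?_ hγ.1 ?_
    hγ.2.1 ?_
  · exact fun s hs t ht => (hγ.2.2 s hs t ht).le
  · intro s hs t ht
    refine (hσ.dist_le _ (hm s hs) _ (hm t ht)).trans ?_
    rw [← hγ.2.2 s hs t ht]
    exact abs_dist_sub_le _ _ _
  · intro t ht
    rw [hσ.height _ (hm t ht)]
  · rw [hγ.1, hx, dist_fst]
  · rw [hγ.2.1, hy, dist_fst]

/-- Moving along a geodesic in the second factor, while the first coordinate adjusts its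
height along a vertical geodesic. -/
lemma dist_le_of_fst_vertical {a : X₁} {σ : ℝ → X₁} (hσ : IsVertical z₁ a σ)
    {x y : HyperbolicProduct z₁ z₂} (hx : x.fst = σ x.height) (hy : y.fst = σ y.height)
    (hxa : x.height + dist x.snd y.snd ≤ dist a z₁) : dist x y ≤ √2 * dist x.snd y.snd := by
  obtain ⟨γ, hγ⟩ := GeodesicSpace.exists_geodesicPath x.snd y.snd
  have hm : ∀ t ∈ Icc 0 (dist x.snd y.snd), dist (γ t) z₂ ∈ Icc 0 (dist a z₁) := by
    intro t ht
    refine ⟨dist_nonneg, ?_⟩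
    have := hγ.dist_left ht
    linarith [dist_triangle_left (γ t) z₂ x.snd, ht.2, dist_snd x]
  refine dist_le_of_lipschitz dist_nonneg (fun t => σ (dist (γ t) z₂)) γ ?_ ?_ ?_ ?_ hγ.1 ?_
    hγ.2.1
  · intro s hs t ht
    refine (hσ.dist_le _ (hm s hs) _ (hm t ht)).trans ?_
    rw [← hγ.2.2 s hs t ht]
    exact abs_dist_sub_le _ _ _
  · exact fun s hs t ht => (hγ.2.2 s hs t ht).le
  · intro t ht
    rw [hσ.height _ (hm t ht)]
  · rw [hγ.1, hx, dist_snd]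
  · rw [hγ.2.1, hy, dist_snd]

/-- Two points can be joined by descending to a height `s` where vertical geodesics in both
factors are `η`-close, changing the vertical geodesics one after the other, and ascending. There
must be room of size `η` above `s`, since the height may vary while the geodesics are changed. -/
lemma dist_le_of_crossing {a b : HyperbolicProduct z₁ z₂} {σ₁ τ₁ : ℝ → X₁} {σ₂ τ₂ : ℝ → X₂}
    (hσ₁ : IsVertical z₁ a.fst σ₁) (hσ₂ : IsVertical z₂ a.snd σ₂)
    (hτ₁ : IsVertical z₁ b.fst τ₁) (hτ₂ : IsVertical z₂ b.snd τ₂) {s η : ℝ} (hs : 0 ≤ s)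
    (h₁ : dist (σ₁ s) (τ₁ s) ≤ η) (h₂ : dist (σ₂ s) (τ₂ s) ≤ η)
    (ha : s + η ≤ a.height) (hb : s + η ≤ b.height) :
    dist a b ≤ √2 * (a.height + b.height - 2 * s + 2 * η) := by
  have hη : 0 ≤ η := dist_nonneg.trans h₁
  have hsa : s ∈ Icc 0 a.height := ⟨hs, by linarith⟩
  have hsb : s ∈ Icc 0 b.height := ⟨hs, by linarith⟩
  have hsa' : s ∈ Icc 0 (dist a.snd z₂) := by rwa [dist_snd]
  have hsb' : s ∈ Icc 0 (dist b.snd z₂) := by rwa [dist_snd]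
  let P := ofVertical hσ₁ hσ₂ s hsa
  let Q : HyperbolicProduct z₁ z₂ := ofCoords (τ₁ s) (σ₂ s) (by
    rw [hτ₁.height s hsb, hσ₂.height s hsa'])
  let R := ofVertical hτ₁ hτ₂ s hsb
  have hP : P.height = s := hσ₁.height s hsa
  have hQ : Q.height = s := hτ₁.height s hsb
  have hR : R.height = s := hτ₁.height s hsb
  have d1 : dist P a ≤ √2 * (a.height - s) := dist_ofVertical_le hσ₁ hσ₂ s hsa
  have d2 : dist P Q ≤ √2 * dist (σ₁ s) (τ₁ s) := by
    refine dist_le_of_snd_vertical hσ₂ (by rw [hP]; rfl) (by rw [hQ]; rfl) ?_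
    rw [hP, dist_snd]
    exact (add_le_add_right h₁ s).trans ha
  have d3 : dist Q R ≤ √2 * dist (σ₂ s) (τ₂ s) := by
    refine dist_le_of_fst_vertical hτ₁ (by rw [hQ]; rfl) (by rw [hR]; rfl) ?_
    rw [hQ, dist_fst]
    exact (add_le_add_right h₂ s).trans hb
  have d4 : dist R b ≤ √2 * (b.height - s) := dist_ofVertical_le hτ₁ hτ₂ s hsb
  have e1 := mul_le_mul_of_nonneg_left h₁ (Real.sqrt_nonneg 2)
  have e2 := mul_le_mul_of_nonneg_left h₂ (Real.sqrt_nonneg 2)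
  have := dist_triangle4 P Q R b
  linarith [dist_triangle_left a b P]

variable (z₁ z₂) in
/-- The pair of basepoints. -/
def base : HyperbolicProduct z₁ z₂ := ofCoords z₁ z₂ (by rw [dist_self, dist_self])

lemma dist_base (a : HyperbolicProduct z₁ z₂) : dist a (base z₁ z₂) = √2 * a.height := by
  refine le_antisymm ?_ ?_
  · obtain ⟨σ₁, h₁⟩ := exists_isVertical z₁ a.fst
    obtain ⟨σ₂, h₂⟩ := exists_isVertical z₂ a.snd
    have h0 : (0 : ℝ) ∈ Icc 0 a.height := ⟨le_rfl, a.height_nonneg⟩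
    have := dist_ofVertical_le h₁ h₂ 0 h0
    have e : ofVertical h₁ h₂ 0 h0 = base z₁ z₂ := by
      refine ext_coords ?_ ?_
      · exact dist_eq_zero.1 (h₁.height 0 h0)
      · exact dist_eq_zero.1 (h₂.height 0 ⟨le_rfl, dist_nonneg⟩)
    rwa [e, sub_zero, dist_comm] at this
  · refine le_trans (le_of_eq ?_) (dist_toSubset_le_dist _ _)
    rw [dist_toSubset]
    have e1 : dist a.toSubset.1.fst (base z₁ z₂).toSubset.1.fst = a.height := rfl
    have e2 : dist a.toSubset.1.snd (base z₁ z₂).toSubset.1.snd = a.height := a.dist_snd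
    rw [e1, e2, ← two_mul, Real.sqrt_mul zero_le_two, Real.sqrt_sq a.height_nonneg]

/-! ### The Gromov product of the product -/

/-- The upper bound for distances in the product: cross over at distance `4 * δ` below the height
up to which the vertical geodesics to `a` and `b` are `4 * δ`-close. -/
lemma dist_le_of_fourPoint {δ : ℝ} (hδ : 0 ≤ δ) (hX₁ : FourPoint X₁ δ) (hX₂ : FourPoint X₂ δ)
    (a b : HyperbolicProduct z₁ z₂) :
    dist a b ≤ √2 * (a.height + b.height -
      2 * min (gromovProduct z₁ a.fst b.fst) (gromovProduct z₂ a.snd b.snd) + 16 * δ) := by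
  obtain ⟨σ₁, hσ₁⟩ := exists_isVertical z₁ a.fst
  obtain ⟨σ₂, hσ₂⟩ := exists_isVertical z₂ a.snd
  obtain ⟨τ₁, hτ₁⟩ := exists_isVertical z₁ b.fst
  obtain ⟨τ₂, hτ₂⟩ := exists_isVertical z₂ b.snd
  set g := min (gromovProduct z₁ a.fst b.fst) (gromovProduct z₂ a.snd b.snd) with hg
  have hg1 : g ≤ gromovProduct z₁ a.fst b.fst := min_le_left _ _
  have hg2 : g ≤ gromovProduct z₂ a.snd b.snd := min_le_right _ _
  rcases le_or_gt (4 * δ) g with hc | hc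
  · have h := dist_le_of_crossing hσ₁ hσ₂ hτ₁ hτ₂ (s := g - 4 * δ) (η := 4 * δ) (by linarith)
      (hσ₁.dist_le_of_le_gromovProduct hX₁ hδ hτ₁ (by linarith) (by linarith))
      (hσ₂.dist_le_of_le_gromovProduct hX₂ hδ hτ₂ (by linarith) (by linarith))
      (by linarith [gromovProduct_le_left z₁ a.fst b.fst, a.dist_fst])
      (by linarith [gromovProduct_le_right z₁ a.fst b.fst, b.dist_fst])
    refine h.trans (le_of_eq ?_)
    ring
  · refine (dist_triangle_right a b (base z₁ z₂)).trans ?_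
    rw [dist_base, dist_base, ← mul_add]
    refine mul_le_mul_of_nonneg_left ?_ (Real.sqrt_nonneg 2)
    linarith

/-- The lower bound for distances in the product, from each of the factors: a curve in the product
projects to the factors, and its length bounds the sum of horizontal and vertical length of the
projections. -/
lemma exists_le_dist_of_fourPoint {δ : ℝ} (hδ : 0 ≤ δ) (hX₁ : FourPoint X₁ δ)
    (hX₂ : FourPoint X₂ δ) : ∃ C : ℝ, ∀ a b : HyperbolicProduct z₁ z₂,
    √2 * (a.height + b.height -
      2 * min (gromovProduct z₁ a.fst b.fst) (gromovProduct z₂ a.snd b.snd)) - C ≤ dist a b := by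
  obtain ⟨C₁, hC₁⟩ := exists_le_chain_length hX₁ hδ
  obtain ⟨C₂, hC₂⟩ := exists_le_chain_length hX₂ hδ
  refine ⟨max C₁ C₂ / √2, fun a b => le_of_forall_pos_le_add fun ε hε => ?_⟩
  obtain ⟨c, hc, hcε⟩ := exists_curveLength_le a b hε
  obtain ⟨N, p, hp0, hpN, hstep, hsum⟩ := exists_chain_of_path c hc
  set S := ∑ i ∈ Finset.range N, dist (p i) (p (i + 1)) with hS
  have h1 := hC₁ z₁ (fun i => (p i).1.fst) N fun i _ => by
    refine le_trans ?_ (hstep i)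
    rw [dist_toSubset]
    exact Real.le_sqrt_of_sq_le (le_add_of_nonneg_right (sq_nonneg _))
  have h2 := hC₂ z₂ (fun i => (p i).1.snd) N fun i _ => by
    refine le_trans ?_ (hstep i)
    rw [dist_toSubset]
    exact Real.le_sqrt_of_sq_le (le_add_of_nonneg_left (sq_nonneg _))
  have k1 := h1.trans (Finset.sum_le_sum fun i _ => (add_abs_le_dist_toSubset (p i) (p (i + 1))).1)
  have k2 := h2.trans (Finset.sum_le_sum fun i _ => (add_abs_le_dist_toSubset (p i) (p (i + 1))).2)
  rw [← Finset.mul_sum, ← hS, hp0, hpN] at k1 k2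
  change 2 * (dist a.fst z₁ + dist b.fst z₁ - 2 * gromovProduct z₁ a.fst b.fst) - C₁ ≤ _ at k1
  change 2 * (dist a.snd z₂ + dist b.snd z₂ - 2 * gromovProduct z₂ a.snd b.snd) - C₂ ≤ _ at k2
  rw [dist_fst, dist_fst] at k1
  rw [dist_snd, dist_snd] at k2
  have hsq : √2 * √2 = (2 : ℝ) := Real.mul_self_sqrt zero_le_two
  have hs0 : 0 < √(2 : ℝ) := Real.sqrt_pos.2 two_pos
  set g := min (gromovProduct z₁ a.fst b.fst) (gromovProduct z₂ a.snd b.snd) with hg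
  have k3 : 2 * (a.height + b.height - 2 * g) - max C₁ C₂ ≤ √2 * S := by
    rcases min_choice (gromovProduct z₁ a.fst b.fst) (gromovProduct z₂ a.snd b.snd) with h | h
    · rw [hg, h]
      linarith [le_max_left C₁ C₂]
    · rw [hg, h]
      linarith [le_max_right C₁ C₂]
  have k4 : √2 * (√2 * (a.height + b.height - 2 * g) - max C₁ C₂ / √2) ≤ √2 * S := by
    rw [mul_sub, ← mul_assoc, hsq, mul_div_cancel₀ _ hs0.ne']
    exact k3
  linarith [le_of_mul_le_mul_left k4 hs0]

/-- Up to a constant, the Gromov product at the pair of basepoints is `√2` times the minimum of the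
Gromov products of the coordinates. -/
lemma exists_abs_gromovProduct_base_sub_le {δ : ℝ} (hδ : 0 ≤ δ) (hX₁ : FourPoint X₁ δ)
    (hX₂ : FourPoint X₂ δ) : ∃ C : ℝ, ∀ a b : HyperbolicProduct z₁ z₂,
    |gromovProduct (base z₁ z₂) a b -
      √2 * min (gromovProduct z₁ a.fst b.fst) (gromovProduct z₂ a.snd b.snd)| ≤ C := by
  obtain ⟨C, hC⟩ := exists_le_dist_of_fourPoint (z₁ := z₁) (z₂ := z₂) hδ hX₁ hX₂
  refine ⟨max C (√2 * (16 * δ)) / 2, fun a b => ?_⟩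
  have h1 := hC a b
  have h2 := dist_le_of_fourPoint hδ hX₁ hX₂ a b
  have h3 := le_max_left C (√2 * (16 * δ))
  have h4 := le_max_right C (√2 * (16 * δ))
  unfold gromovProduct at *
  rw [dist_base, dist_base, abs_le]
  constructor <;> linarith

/-- `exists_abs_gromovProduct_base_sub_le` for arbitrary basepoints. -/
lemma exists_abs_gromovProduct_sub_le {δ : ℝ} (hδ : 0 ≤ δ) (hX₁ : FourPoint X₁ δ)
    (hX₂ : FourPoint X₂ δ) (o : HyperbolicProduct z₁ z₂) (o₁ : X₁) (o₂ : X₂) :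
    ∃ C : ℝ, ∀ a b : HyperbolicProduct z₁ z₂,
      |gromovProduct o a b -
        √2 * min (gromovProduct o₁ a.fst b.fst) (gromovProduct o₂ a.snd b.snd)| ≤ C := by
  obtain ⟨C, hC⟩ := exists_abs_gromovProduct_base_sub_le (z₁ := z₁) (z₂ := z₂) hδ hX₁ hX₂
  refine ⟨C + dist o (base z₁ z₂) + √2 * max (dist o₁ z₁) (dist o₂ z₂), fun a b => ?_⟩
  have h0 := abs_gromovProduct_sub_le o (base z₁ z₂) a b
  have h1 := (abs_min_sub_min_le_max (gromovProduct z₁ a.fst b.fst) (gromovProduct z₂ a.snd b.snd)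
    (gromovProduct o₁ a.fst b.fst) (gromovProduct o₂ a.snd b.snd)).trans
    (max_le_max (abs_gromovProduct_sub_le z₁ o₁ a.fst b.fst)
      (abs_gromovProduct_sub_le z₂ o₂ a.snd b.snd))
  rw [dist_comm z₁, dist_comm z₂] at h1
  have h2 := mul_le_mul_of_nonneg_left h1 (Real.sqrt_nonneg 2)
  rw [← abs_of_nonneg (Real.sqrt_nonneg 2), ← abs_mul, abs_of_nonneg (Real.sqrt_nonneg 2),
    mul_sub] at h2
  have h3 := hC a b
  rw [abs_le] at *
  constructor <;> linarith

lemma exists_fourPointAt {δ : ℝ} (hδ : 0 ≤ δ) (hX₁ : FourPoint X₁ δ)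
    (hX₂ : FourPoint X₂ δ) (o : HyperbolicProduct z₁ z₂) :
    ∃ δ' : ℝ, 0 ≤ δ' ∧ FourPointAt o δ' := by
  obtain ⟨C, hC⟩ := exists_abs_gromovProduct_sub_le hδ hX₁ hX₂ o z₁ z₂
  have hC0 : 0 ≤ C := (abs_nonneg _).trans (hC o o)
  refine ⟨2 * C + √2 * δ, by positivity, fun a b c => ?_⟩
  have hab := neg_le_of_abs_le (hC a b)
  have hac := le_of_abs_le (hC a c)
  have hcb := le_of_abs_le (hC c b)
  have key : min (min (gromovProduct z₁ a.fst c.fst) (gromovProduct z₂ a.snd c.snd))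
      (min (gromovProduct z₁ c.fst b.fst) (gromovProduct z₂ c.snd b.snd)) ≤
      min (gromovProduct z₁ a.fst b.fst) (gromovProduct z₂ a.snd b.snd) + δ := by
    rw [min_min_min_comm, ← min_add_add_right]
    exact min_le_min (hX₁ z₁ a.fst b.fst c.fst) (hX₂ z₂ a.snd b.snd c.snd)
  have hs := Real.sqrt_nonneg (2 : ℝ)
  rcases min_le_iff.1 key with h | h
  · have := mul_le_mul_of_nonneg_left h hs
    exact (min_le_left _ _).trans (by linarith)
  · have := mul_le_mul_of_nonneg_left h hs
    exact (min_le_right _ _).trans (by linarith)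

lemma isHyperbolic {δ : ℝ} (hδ : 0 ≤ δ) (hX₁ : FourPoint X₁ δ) (hX₂ : FourPoint X₂ δ) :
    IsHyperbolic (HyperbolicProduct z₁ z₂) := by
  obtain ⟨δ', hδ', h⟩ := exists_fourPointAt hδ hX₁ hX₂ (base z₁ z₂)
  exact ⟨6 * δ', by positivity, isDeltaHyperbolic_of_basepoint h⟩

end HyperbolicProduct

/-! ### Properness and existence of geodesics -/

lemma interiorEDist_le_eVariationOn_Icc {E : Type*} [MetricSpace E] {x y : E} (c : Path x y)
    {s t : unitInterval} (hst : s ≤ t) :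
    interiorEDist (c s) (c t) ≤ eVariationOn (c : unitInterval → E) (univ ∩ Icc s t) := by
  have hst' : (s : ℝ) ≤ t := hst
  have hm : ∀ r : unitInterval, (s : ℝ) + r * (t - s) ∈ Icc (s : ℝ) t := fun r =>
    ⟨le_add_of_nonneg_right (mul_nonneg r.2.1 (sub_nonneg.2 hst')),
      by nlinarith [r.2.2, mul_le_of_le_one_left (sub_nonneg.2 hst') r.2.2]⟩
  let φ : unitInterval → unitInterval := fun r =>
    ⟨s + r * (t - s), s.2.1.trans (hm r).1, (hm r).2.trans t.2.2⟩
  have hφ : Continuous φ := by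
    refine Continuous.subtype_mk ?_ _
    fun_prop
  let c' : Path (c s) (c t) :=
    { toFun := fun r => c (φ r)
      continuous_toFun := c.continuous.comp hφ
      source' := by
        congr 1
        ext
        simp [φ]
      target' := by
        congr 1
        ext
        simp [φ] }
  refine (iInf_le _ c').trans (eVariationOn.comp_le_of_monotoneOn _ φ ?_ ?_)
  · intro r _ r' _ h
    have h' : (r : ℝ) ≤ r' := h
    change (s : ℝ) + r * (t - s) ≤ s + r' * (t - s)
    have := sub_nonneg.2 hst'
    gcongr
  · exact fun r _ => ⟨mem_univ _, (hm r).1, (hm r).2⟩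

/-- In a proper space, geodesics exist if there are arbitrarily good approximations of them, which
need not be continuous. -/
lemma geodesicSpace_of_approx {X : Type*} [MetricSpace X] [ProperSpace X]
    (h : ∀ (x y : X) (ε : ℝ), 0 < ε → ∃ γ : ℝ → X, dist (γ 0) x ≤ ε ∧ dist (γ (dist x y)) y ≤ ε ∧
      ∀ s ∈ Icc 0 (dist x y), ∀ t ∈ Icc 0 (dist x y), dist (γ s) (γ t) ≤ |s - t| + ε) :
    GeodesicSpace X := by
  refine ⟨fun x y => ?_⟩
  set L := dist x y with hL
  have hL0 : 0 ≤ L := dist_nonneg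
  choose γ h0 h1 h2 using fun n : ℕ => h x y (1 / ((n : ℝ) + 1)) (by positivity)
  let U : Ultrafilter ℕ := hyperfilter ℕ
  have hU : (U : Filter ℕ) ≤ atTop := Nat.hyperfilter_le_atTop
  have hε : Tendsto (fun n : ℕ => 1 / ((n : ℝ) + 1)) U (nhds 0) :=
    tendsto_one_div_add_atTop_nhds_zero_nat.mono_left hU
  have hε1 : ∀ n : ℕ, 1 / ((n : ℝ) + 1) ≤ 1 := fun n => by
    rw [div_le_one (by positivity)]
    linarith [n.cast_nonneg (α := ℝ)]
  have hlim : ∀ s, ∃ p, s ∈ Icc 0 L → Tendsto (fun n => γ n s) U (nhds p) := by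
    intro s
    by_cases hs : s ∈ Icc 0 L
    · obtain ⟨p, -, hp⟩ := (isCompact_closedBall x (L + 2)).ultrafilter_le_nhds
        (U.map fun n => γ n s) (by
          rw [Ultrafilter.coe_map, le_principal_iff, mem_map]
          refine Eventually.of_forall fun n => ?_
          have := h2 n s hs 0 ⟨le_rfl, hL0⟩
          rw [sub_zero, abs_of_nonneg hs.1] at this
          change dist (γ n s) x ≤ L + 2
          linarith [dist_triangle (γ n s) (γ n 0) x, hs.2, hε1 n, h0 n])
      exact ⟨p, fun _ => hp⟩
    · exact ⟨x, fun h => absurd h hs⟩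
  choose η hη using hlim
  have hη0 : η 0 = x := by
    rw [← dist_le_zero]
    exact le_of_tendsto_of_tendsto ((hη 0 ⟨le_rfl, hL0⟩).dist tendsto_const_nhds) hε
      (Eventually.of_forall h0)
  have hη1 : η L = y := by
    rw [← dist_le_zero]
    exact le_of_tendsto_of_tendsto ((hη L ⟨hL0, le_rfl⟩).dist tendsto_const_nhds) hε
      (Eventually.of_forall h1)
  have hlip : ∀ s ∈ Icc 0 L, ∀ t ∈ Icc 0 L, dist (η s) (η t) ≤ |s - t| := by
    intro s hs t ht
    have h3 := tendsto_const_nhds (x := |s - t|).add hε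
    rw [add_zero] at h3
    exact le_of_tendsto_of_tendsto ((hη s hs).dist (hη t ht)) h3
      (Eventually.of_forall fun n => h2 n s hs t ht)
  have hiso : ∀ s ∈ Icc 0 L, ∀ t ∈ Icc 0 L, s ≤ t → t - s ≤ dist (η s) (η t) := by
    intro s hs t ht hst
    have e1 := hlip 0 ⟨le_rfl, hL0⟩ s hs
    have e2 := hlip t ht L ⟨hL0, le_rfl⟩
    rw [hη0, zero_sub, abs_neg, abs_of_nonneg hs.1] at e1
    rw [hη1, abs_sub_comm, abs_of_nonneg (sub_nonneg.2 ht.2)] at e2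
    linarith [dist_triangle4 x (η s) (η t) y]
  refine ⟨η, hη0, hη1, fun s hs t ht => le_antisymm (hlip s hs t ht) ?_⟩
  rcases le_total s t with hst | hst
  · rw [abs_sub_comm, abs_of_nonneg (sub_nonneg.2 hst)]
    exact hiso s hs t ht hst
  · rw [abs_of_nonneg (sub_nonneg.2 hst), dist_comm]
    exact hiso t ht s hs hst

namespace HyperbolicProduct

variable {X₁ X₂ : Type*} [MetricSpace X₁] [MetricSpace X₂] [GeodesicSpace X₁] [GeodesicSpace X₂]
  {z₁ : X₁} {z₂ : X₂}

lemma dist_le_add_height (a b : HyperbolicProduct z₁ z₂) :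
    dist a b ≤ √2 * (a.height + b.height) := by
  have := dist_triangle_right a b (base z₁ z₂)
  rw [dist_base, dist_base] at this
  linarith

lemma dist_add_dist_add_dist_le {x y : HyperbolicProduct z₁ z₂}
    (c : Path x.toSubset y.toSubset) (hc : curveLength c ≠ ⊤) {s t : unitInterval} (hst : s ≤ t) :
    dist x ⟨c s⟩ + dist (⟨c s⟩ : HyperbolicProduct z₁ z₂) ⟨c t⟩ + dist ⟨c t⟩ y ≤
      (curveLength c).toReal := by
  have h0 : (0 : unitInterval) ≤ s := s.2.1
  have h1 : t ≤ (1 : unitInterval) := t.2.2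
  have e1 := interiorEDist_le_eVariationOn_Icc c h0
  have e2 := interiorEDist_le_eVariationOn_Icc c hst
  have e3 := interiorEDist_le_eVariationOn_Icc c h1
  rw [c.source] at e1
  rw [c.target] at e3
  have hsum := add_le_add (add_le_add e1 e2) e3
  rw [eVariationOn.Icc_add_Icc _ h0 hst (mem_univ _),
    eVariationOn.Icc_add_Icc _ (h0.trans hst) h1 (mem_univ _)] at hsum
  have hle := hsum.trans (eVariationOn.mono _ (subset_univ _))
  have := ENNReal.toReal_mono hc hle
  rwa [ENNReal.toReal_add, ENNReal.toReal_add] at this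
  all_goals simp [interiorEDist_ne_top]

section Proper

variable [ProperSpace X₁] [ProperSpace X₂]

/-- A sequence whose coordinates converge comes arbitrarily close to the limit in the interior
metric: after a descent by a small amount there is room to move horizontally, and vertical
geodesics subconverge to vertical geodesics. -/
lemma exists_dist_lt_of_tendsto {y : ℕ → HyperbolicProduct z₁ z₂} {p : HyperbolicProduct z₁ z₂}
    (h₁ : Tendsto (fun n => (y n).fst) atTop (nhds p.fst))
    (h₂ : Tendsto (fun n => (y n).snd) atTop (nhds p.snd)) {ε : ℝ} (hε : 0 < ε) :
    ∃ n, dist (y n) p < ε := by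
  have hs2 : √(2 : ℝ) ≤ 2 := Real.sqrt_le_left (by norm_num) |>.2 (by norm_num)
  have hheight : Tendsto (fun n => (y n).height) atTop (nhds p.height) :=
    h₁.dist tendsto_const_nhds
  rcases p.height_nonneg.eq_or_lt with hp | hp
  · obtain ⟨n, hn⟩ := (hheight.eventually (gt_mem_nhds (show p.height < ε / 2 by
      rw [← hp]; positivity))).exists
    refine ⟨n, (dist_le_add_height _ _).trans_lt ?_⟩
    rw [← hp, add_zero]
    nlinarith [(y n).height_nonneg]
  · -- descend by `δ`; heights and horizontal distances then need to agree up to `δ / 4` only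
    set δ := min p.height (ε / 6) with hδdef
    have hδ : 0 < δ := lt_min hp (by positivity)
    have hδp : δ ≤ p.height := min_le_left _ _
    have hδε : δ ≤ ε / 6 := min_le_right _ _
    set s := p.height - δ with hs
    have hs0 : 0 ≤ s := sub_nonneg.2 hδp
    have hev : ∀ᶠ n in atTop, p.height - δ / 4 < (y n).height ∧ (y n).height < p.height + δ / 4 :=
      (hheight.eventually (lt_mem_nhds (by linarith))).and
        (hheight.eventually (gt_mem_nhds (by linarith)))
    choose σ₁ hσ₁ using fun n => exists_isVertical z₁ (y n).fst
    choose σ₂ hσ₂ using fun n => exists_isVertical z₂ (y n).snd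
    have hK : IsCompact (Metric.closedBall z₁ s ×ˢ Metric.closedBall z₂ s) :=
      (isCompact_closedBall _ _).prod (isCompact_closedBall _ _)
    have hsn : ∀ᶠ n in atTop, s ∈ Icc 0 (y n).height := hev.mono fun n hn => ⟨hs0, by linarith⟩
    have hd₁ : ∀ᶠ n in atTop, dist (σ₁ n s) z₁ = s := hsn.mono fun n hn => (hσ₁ n).height s hn
    have hd₂ : ∀ᶠ n in atTop, dist (σ₂ n s) z₂ = s := hsn.mono fun n hn =>
      (hσ₂ n).height s (by rwa [dist_snd])
    have hf₁ : ∀ᶠ n in atTop, dist (y n).fst (σ₁ n s) = (y n).height - s := hsn.mono fun n hn => by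
      rw [dist_comm, (hσ₁ n).dist_apply_self hn, dist_fst]
    have hf₂ : ∀ᶠ n in atTop, dist (y n).snd (σ₂ n s) = (y n).height - s := hsn.mono fun n hn => by
      rw [dist_comm, (hσ₂ n).dist_apply_self (by rwa [dist_snd]), dist_snd]
    obtain ⟨⟨a₁, a₂⟩, -, φ, hφ, ha⟩ := hK.tendsto_subseq' (x := fun n => (σ₁ n s, σ₂ n s))
      ((hd₁.and hd₂).mono fun n hn => ⟨hn.1.le, hn.2.le⟩).frequently
    have hφt := hφ.tendsto_atTop
    have ha₁ : Tendsto (fun n => σ₁ (φ n) s) atTop (nhds a₁) := ((continuous_fst.tendsto _).comp ha)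
    have ha₂ : Tendsto (fun n => σ₂ (φ n) s) atTop (nhds a₂) := ((continuous_snd.tendsto _).comp ha)
    have hz₁ : dist a₁ z₁ = s := tendsto_nhds_unique (ha₁.dist tendsto_const_nhds)
      (tendsto_const_nhds.congr' ((hφt.eventually hd₁).mono fun n hn => hn.symm))
    have hz₂ : dist a₂ z₂ = s := tendsto_nhds_unique (ha₂.dist tendsto_const_nhds)
      (tendsto_const_nhds.congr' ((hφt.eventually hd₂).mono fun n hn => hn.symm))
    have hh := (hheight.comp hφt).sub (tendsto_const_nhds (x := s))
    have hp₁ : dist p.fst a₁ = p.height - s := tendsto_nhds_unique ((h₁.comp hφt).dist ha₁)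
      (hh.congr' ((hφt.eventually hf₁).mono fun n hn => hn.symm))
    have hp₂ : dist p.snd a₂ = p.height - s := tendsto_nhds_unique ((h₂.comp hφt).dist ha₂)
      (hh.congr' ((hφt.eventually hf₂).mono fun n hn => hn.symm))
    obtain ⟨τ₁, hτ₁, hτa₁⟩ := exists_isVertical_through (z := z₁) (a := p.fst) (p := a₁)
      (by rw [hp₁, hz₁, dist_fst]; ring)
    obtain ⟨τ₂, hτ₂, hτa₂⟩ := exists_isVertical_through (z := z₂) (a := p.snd) (p := a₂)
      (by rw [hp₂, hz₂, dist_snd]; ring)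
    rw [hz₁] at hτa₁
    rw [hz₂] at hτa₂
    obtain ⟨n, hn, hn₁, hn₂⟩ := ((hφt.eventually hev).and
      ((ha₁.eventually (Metric.closedBall_mem_nhds a₁ (show 0 < δ / 4 by positivity))).and
      (ha₂.eventually (Metric.closedBall_mem_nhds a₂ (show 0 < δ / 4 by positivity))))).exists
    refine ⟨φ n, (dist_le_of_crossing (hσ₁ _) (hσ₂ _) hτ₁ hτ₂ hs0 (η := δ / 4) (by rwa [hτa₁])
      (by rwa [hτa₂]) (by linarith) (by linarith)).trans_lt ?_⟩
    nlinarith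

/-- The interior metric induces the topology of the product metric. -/
lemma tendsto_of_coords {y : ℕ → HyperbolicProduct z₁ z₂} {p : HyperbolicProduct z₁ z₂}
    (h₁ : Tendsto (fun n => (y n).fst) atTop (nhds p.fst))
    (h₂ : Tendsto (fun n => (y n).snd) atTop (nhds p.snd)) : Tendsto y atTop (nhds p) := by
  rw [Metric.tendsto_nhds]
  intro ε hε
  by_contra hcon
  obtain ⟨φ, hφ, h⟩ := extraction_of_frequently_atTop (not_eventually.1 hcon)
  obtain ⟨n, hn⟩ := exists_dist_lt_of_tendsto (y := y ∘ φ) (h₁.comp hφ.tendsto_atTop)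
    (h₂.comp hφ.tendsto_atTop) hε
  exact h n hn

lemma continuous_mk :
    Continuous (HyperbolicProduct.mk : equidistantSet z₁ z₂ → HyperbolicProduct z₁ z₂) := by
  rw [continuous_iff_seqContinuous]
  intro u p hu
  have hu' : Tendsto (fun n => (u n).1) atTop (nhds p.1) :=
    (continuous_subtype_val.tendsto p).comp hu
  have h := ((WithLp.prod_continuous_ofLp 2 X₁ X₂).tendsto p.1).comp hu'
  exact tendsto_of_coords (p := ⟨p⟩) ((continuous_fst.tendsto _).comp h)
    ((continuous_snd.tendsto _).comp h)

lemma properSpace : ProperSpace (HyperbolicProduct z₁ z₂) := by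
  refine ⟨fun x r => IsSeqCompact.isCompact fun y hy => ?_⟩
  obtain ⟨⟨p₁, p₂⟩, -, φ, hφ, hp⟩ := ((isCompact_closedBall x.fst r).prod
    (isCompact_closedBall x.snd r)).tendsto_subseq (x := fun n => ((y n).fst, (y n).snd))
    fun n => ⟨(dist_fst_le _ _).trans (hy n), (dist_snd_le _ _).trans (hy n)⟩
  have hp₁ : Tendsto (fun n => (y (φ n)).fst) atTop (nhds p₁) := (continuous_fst.tendsto _).comp hp
  have hp₂ : Tendsto (fun n => (y (φ n)).snd) atTop (nhds p₂) := (continuous_snd.tendsto _).comp hp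
  have h : dist p₁ z₁ = dist p₂ z₂ := by
    refine tendsto_nhds_unique (hp₁.dist (tendsto_const_nhds (x := z₁)))
      ((hp₂.dist (tendsto_const_nhds (x := z₂))).congr fun n => ?_)
    rw [dist_fst, dist_snd]
  have hlim : Tendsto (y ∘ φ) atTop (nhds (ofCoords p₁ p₂ h)) := tendsto_of_coords hp₁ hp₂
  exact ⟨_, Metric.isClosed_closedBall.mem_of_tendsto hlim (Eventually.of_forall fun n => hy _),
    φ, hφ, hlim⟩

lemma geodesicSpace : GeodesicSpace (HyperbolicProduct z₁ z₂) := by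
  have := properSpace (z₁ := z₁) (z₂ := z₂)
  refine geodesicSpace_of_approx fun x y ε hε => ?_
  obtain ⟨c, hc, hcε⟩ := exists_curveLength_le x y hε
  have hcont : Continuous fun t => dist x (⟨c t⟩ : HyperbolicProduct z₁ z₂) :=
    continuous_const.dist (continuous_mk.comp c.continuous)
  have hx : (⟨c 0⟩ : HyperbolicProduct z₁ z₂) = x := by rw [c.source]
  have hy : (⟨c 1⟩ : HyperbolicProduct z₁ z₂) = y := by rw [c.target]
  -- reparameterize the curve by the distance to its starting point
  have hex : ∀ s, ∃ t : unitInterval, s ∈ Icc 0 (dist x y) →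
      dist x (⟨c t⟩ : HyperbolicProduct z₁ z₂) = s := by
    intro s
    by_cases hs : s ∈ Icc 0 (dist x y)
    · obtain ⟨t, ht⟩ := mem_range_of_exists_le_of_exists_ge (c := s) hcont
        ⟨0, by rw [hx, dist_self]; exact hs.1⟩ ⟨1, by rw [hy]; exact hs.2⟩
      exact ⟨t, fun _ => ht⟩
    · exact ⟨0, fun h => absurd h hs⟩
  choose τ hτ using hex
  refine ⟨fun s => ⟨c (τ s)⟩, ?_, ?_, ?_⟩
  · rw [dist_comm, hτ 0 ⟨le_rfl, dist_nonneg⟩]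
    exact hε.le
  · have h1 := dist_add_dist_add_dist_le c hc (le_refl (τ (dist x y)))
    rw [hτ _ ⟨dist_nonneg, le_rfl⟩, dist_self] at h1
    linarith
  · intro s hs t ht
    have key : ∀ s ∈ Icc 0 (dist x y), ∀ t ∈ Icc 0 (dist x y), τ s ≤ τ t →
        dist (⟨c (τ s)⟩ : HyperbolicProduct z₁ z₂) ⟨c (τ t)⟩ ≤ |s - t| + ε := by
      intro s hs t ht hst
      have h1 := dist_add_dist_add_dist_le c hc hst
      have h2 := dist_triangle x (⟨c (τ t)⟩ : HyperbolicProduct z₁ z₂) y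
      rw [hτ s hs] at h1
      rw [hτ t ht] at h2
      linarith [neg_le_abs (s - t)]
    rcases le_total (τ s) (τ t) with h | h
    · exact key s hs t ht h
    · rw [dist_comm, abs_sub_comm]
      exact key t ht s hs h

end Proper

end HyperbolicProduct

/-! ### The boundary in terms of eventual lower bounds -/

section Boundary

variable {X : Type*} [MetricSpace X]

/-- The Gromov products `(x^k · y^l)_o` are eventually at least `R`, as `k` and `l` both tend to
infinity. -/
def EventuallyProductGE (o : X) (x y : ℕ → X) (R : ℝ) : Prop :=
  ∃ N, ∀ k, N ≤ k → ∀ l, N ≤ l → R ≤ gromovProduct o (x k) (y l)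

lemma EventuallyProductGE.le_gromovLiminf {o : X} {x y : ℕ → X} {R : ℝ}
    (h : EventuallyProductGE o x y R) : (R : EReal) ≤ gromovLiminf o x y := by
  obtain ⟨N, hN⟩ := h
  exact le_liminf_of_le (by isBoundedDefault) (eventually_atTop.2 ⟨(N, N), fun p hp =>
    EReal.coe_le_coe_iff.2 (hN _ hp.1 _ hp.2)⟩)

lemma eventuallyProductGE_of_lt {o : X} {x y : ℕ → X} {R : ℝ}
    (h : (R : EReal) < gromovLiminf o x y) : EventuallyProductGE o x y R := by
  obtain ⟨⟨a, b⟩, hab⟩ := eventually_atTop.1 (eventually_lt_of_lt_liminf h (by isBoundedDefault))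
  exact ⟨max a b, fun k hk l hl => (EReal.coe_lt_coe_iff.1 (hab (k, l)
    ⟨(le_max_left _ _).trans hk, (le_max_right _ _).trans hl⟩)).le⟩

lemma gromovLiminf_eq_top_iff {o : X} {x y : ℕ → X} :
    gromovLiminf o x y = ⊤ ↔ ∀ R, EventuallyProductGE o x y R :=
  ⟨fun h R => eventuallyProductGE_of_lt (h ▸ EReal.coe_lt_top R),
    fun h => EReal.eq_top_iff_forall_lt _ |>.2 fun R =>
      lt_of_lt_of_le (EReal.coe_lt_coe_iff.2 (lt_add_one R)) (h (R + 1)).le_gromovLiminf⟩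

lemma EventuallyProductGE.mono {o : X} {x y : ℕ → X} {R R' : ℝ}
    (h : EventuallyProductGE o x y R) (hR : R' ≤ R) : EventuallyProductGE o x y R' :=
  let ⟨N, hN⟩ := h
  ⟨N, fun k hk l hl => hR.trans (hN k hk l hl)⟩

lemma EventuallyProductGE.symm {o : X} {x y : ℕ → X} {R : ℝ}
    (h : EventuallyProductGE o x y R) : EventuallyProductGE o y x R :=
  let ⟨N, hN⟩ := h
  ⟨N, fun k hk l hl => gromovProduct_comm o (x l) (y k) ▸ hN l hl k hk⟩

lemma EventuallyProductGE.trans {o : X} {δ : ℝ} (hX : FourPointAt o δ) {x y w : ℕ → X} {R : ℝ}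
    (h : EventuallyProductGE o x y R) (h' : EventuallyProductGE o y w R) :
    EventuallyProductGE o x w (R - δ) := by
  obtain ⟨N, hN⟩ := h
  obtain ⟨N', hN'⟩ := h'
  refine ⟨max N N', fun k hk l hl => ?_⟩
  have h1 := hN k ((le_max_left _ _).trans hk) (max N N') (le_max_left _ _)
  have h2 := hN' (max N N') (le_max_right _ _) l ((le_max_right _ _).trans hl)
  linarith [(le_min h1 h2).trans (hX (x k) (w l) (y (max N N')))]

lemma EventuallyProductGE.change_basepoint {o : X} (o' : X) {x y : ℕ → X} {R : ℝ}
    (h : EventuallyProductGE o x y R) : EventuallyProductGE o' x y (R - dist o o') := by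
  obtain ⟨N, hN⟩ := h
  refine ⟨N, fun k hk l hl => ?_⟩
  linarith [hN k hk l hl, le_of_abs_le (abs_gromovProduct_sub_le o o' (x k) (y l))]

lemma eventuallyProductGE_all_trans {o : X} {δ : ℝ} (hX : FourPointAt o δ) {x y w : ℕ → X}
    (h : ∀ R, EventuallyProductGE o x y R) (h' : ∀ R, EventuallyProductGE o y w R) (R : ℝ) :
    EventuallyProductGE o x w R := by
  simpa using (h (R + δ)).trans hX (h' (R + δ))

lemma Boundary.mk_eq_mk_iff {o : X} {δ : ℝ} (hX : FourPointAt o δ) {x y : ℕ → X}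
    {hx : ConvergesToInfinity o x} {hy : ConvergesToInfinity o y} :
    Boundary.mk o x hx = Boundary.mk o y hy ↔ ∀ R, EventuallyProductGE o x y R := by
  have heq : Equivalence (SeqEquivalent (X := X) o) := by
    refine ⟨fun x => x.2, fun {x y} h => ?_, fun {x y w} h h' => ?_⟩
    · exact gromovLiminf_eq_top_iff.2 fun R => (gromovLiminf_eq_top_iff.1 h R).symm
    · exact gromovLiminf_eq_top_iff.2 (eventuallyProductGE_all_trans hX
        (gromovLiminf_eq_top_iff.1 h) (gromovLiminf_eq_top_iff.1 h'))
  exact heq.quot_mk_eq_iff _ _ |>.trans gromovLiminf_eq_top_iff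

lemma Boundary.exists_rep {o : X} (v : Boundary X o) :
    ∃ x hx, Boundary.mk o x hx = v := by
  obtain ⟨⟨x, hx⟩, rfl⟩ := Quot.exists_rep v
  exact ⟨x, hx, rfl⟩

lemma Boundary.mk_mem_basicNhd {o : X} {x y : ℕ → X} (hx : ConvergesToInfinity o x)
    (hy : ConvergesToInfinity o y) {r : ℝ} (h : EventuallyProductGE o x y r) :
    Boundary.mk o y hy ∈ (Boundary.mk o x hx).basicNhd r :=
  ⟨x, y, hx, hy, rfl, rfl, h.le_gromovLiminf⟩

/-- Membership in `U(v, r)` is independent of the representatives up to an additive constant. -/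
lemma Boundary.eventuallyProductGE_of_mem_basicNhd {o : X} {δ : ℝ} (hX : FourPointAt o δ)
    {x y : ℕ → X} {hx : ConvergesToInfinity o x} {hy : ConvergesToInfinity o y} {r : ℝ}
    (h : Boundary.mk o y hy ∈ (Boundary.mk o x hx).basicNhd r) :
    EventuallyProductGE o x y (r - 1 - 2 * δ) := by
  obtain ⟨x', y', hx', hy', h1, h2, h3⟩ := h
  have h4 : EventuallyProductGE o x' y' (r - 1) := eventuallyProductGE_of_lt
    (lt_of_lt_of_le (EReal.coe_lt_coe_iff.2 (sub_one_lt r)) h3)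
  have h5 := (((Boundary.mk_eq_mk_iff hX).1 h1 _).symm.trans hX h4).trans hX
    ((Boundary.mk_eq_mk_iff hX).1 h2 _)
  exact h5.mono (by linarith)

/-- The sets `U(v, r)` are neighborhoods of `v`, although they need not be open. -/
lemma Boundary.basicNhd_mem_nhds {o : X} {δ : ℝ} (hδ : 0 ≤ δ) (hX : FourPointAt o δ)
    (v : Boundary X o) (r : ℝ) : v.basicNhd r ∈ nhds v := by
  have key : ∀ (w w' w'' : Boundary X o) (s : ℝ), w' ∈ w.basicNhd (s + (1 + 3 * δ)) →
      w'' ∈ w'.basicNhd (s + (1 + 3 * δ)) → w'' ∈ w.basicNhd s := by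
    intro w w' w'' s h h'
    obtain ⟨a, ha, rfl⟩ := w.exists_rep
    obtain ⟨b, hb, rfl⟩ := w'.exists_rep
    obtain ⟨c, hc, rfl⟩ := w''.exists_rep
    refine Boundary.mk_mem_basicNhd ha hc (((Boundary.eventuallyProductGE_of_mem_basicNhd hX h).trans
      hX (Boundary.eventuallyProductGE_of_mem_basicNhd hX h')).mono ?_)
    linarith
  refine mem_nhds_iff.2 ⟨{w | ∃ s : ℝ, 0 < s ∧ w.basicNhd s ⊆ v.basicNhd r}, ?_, ?_, ?_⟩
  · rintro w ⟨s, -, hs⟩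
    obtain ⟨a, ha, rfl⟩ := w.exists_rep
    exact hs (Boundary.mk_mem_basicNhd ha ha (gromovLiminf_eq_top_iff.1 ha s))
  · rintro w ⟨s, hs0, hs⟩
    refine ⟨s + (1 + 3 * δ), by positivity, fun w' hw' => ?_⟩
    exact ⟨s + (1 + 3 * δ), by positivity, fun w'' hw'' => hs (key _ _ _ _ hw' hw'')⟩
  · exact ⟨max r 1, by positivity, v.basicNhd_anti (le_max_left _ _)⟩

variable {X' : Type*} [MetricSpace X']

/-- The map on boundaries induced by a map `f` that preserves convergence to infinity and
equivalence of sequences. -/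
def Boundary.map {o : X} {o' : X'} (f : X → X') (hf : ∀ x y : ℕ → X,
      (∀ R, EventuallyProductGE o x y R) → ∀ R, EventuallyProductGE o' (f ∘ x) (f ∘ y) R) :
    Boundary X o → Boundary X' o' :=
  Quot.lift (fun x => Boundary.mk o' (f ∘ x.1)
    (gromovLiminf_eq_top_iff.2 (hf _ _ (gromovLiminf_eq_top_iff.1 x.2))))
    fun _ _ h => Quot.sound (gromovLiminf_eq_top_iff.2 (hf _ _ (gromovLiminf_eq_top_iff.1 h)))

lemma Boundary.continuous_map {o : X} {o' : X'} {f : X → X'} (hf : ∀ x y : ℕ → X,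
      (∀ R, EventuallyProductGE o x y R) → ∀ R, EventuallyProductGE o' (f ∘ x) (f ∘ y) R)
    (hc : ∀ R, ∃ R', ∀ x y : ℕ → X, EventuallyProductGE o x y R' →
      EventuallyProductGE o' (f ∘ x) (f ∘ y) R) :
    Continuous (Boundary.map (o := o) (o' := o') f hf) := by
  refine continuous_def.2 fun S hS v hv => ?_
  obtain ⟨R, -, hR⟩ := hS _ hv
  obtain ⟨R', hR'⟩ := hc R
  refine ⟨max 1 (R' + 1), by positivity, ?_⟩
  rintro w ⟨x, y, hx, hy, rfl, rfl, h⟩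
  refine hR (Boundary.mk_mem_basicNhd _ _ (hR' x y (eventuallyProductGE_of_lt ?_)))
  exact lt_of_lt_of_le (EReal.coe_lt_coe_iff.2
    ((lt_add_one R').trans_le (le_max_right _ _))) h

end Boundary

/-! ### The boundary of the product -/

namespace HyperbolicProduct

variable {X₁ X₂ : Type*} [MetricSpace X₁] [MetricSpace X₂] {z₁ : X₁} {z₂ : X₂}

/-- A sequence in a factor that converges to infinity may be lowered along vertical geodesics to
heights which still tend to infinity, without changing the boundary point. -/
lemma eventuallyProductGE_vertical {X : Type*} [MetricSpace X] {δ : ℝ} (hX : FourPoint X δ)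
    {z o : X} {x : ℕ → X} (hx : ConvergesToInfinity o x) {σ : ℕ → ℝ → X}
    (hσ : ∀ k, IsVertical z (x k) (σ k)) {h : ℕ → ℝ} (hh : ∀ k, h k ∈ Icc 0 (dist (x k) z))
    (hlim : Tendsto h atTop atTop) (R : ℝ) :
    EventuallyProductGE o x (fun k => σ k (h k)) R := by
  obtain ⟨N, hN⟩ := (gromovLiminf_eq_top_iff.1 hx (R + δ + 2 * dist o z)).change_basepoint z
  obtain ⟨N', hN'⟩ := eventually_atTop.1 (hlim.eventually_ge_atTop (R + δ + dist o z))
  have hz : EventuallyProductGE z x (fun k => σ k (h k)) (R + dist o z) := by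
    refine ⟨max N N', fun k hk l hl => ?_⟩
    have h1 := (hσ l).min_le_gromovProduct hX (hh l) (x k)
    have h2 := hN k ((le_max_left _ _).trans hk) l ((le_max_left _ _).trans hl)
    have h3 := hN' l ((le_max_right _ _).trans hl)
    rcases min_le_iff.1 h1 with h | h <;> linarith
  exact (hz.change_basepoint o).mono (by rw [dist_comm z o]; linarith)

lemma tendsto_dist_of_convergesToInfinity {X : Type*} [MetricSpace X] {o : X} {x : ℕ → X}
    (hx : ConvergesToInfinity o x) (z : X) : Tendsto (fun k => dist (x k) z) atTop atTop := by
  refine tendsto_atTop.2 fun R => ?_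
  obtain ⟨N, hN⟩ := (gromovLiminf_eq_top_iff.1 hx (R + dist o z)).change_basepoint z
  filter_upwards [eventually_ge_atTop N] with k hk
  linarith [hN k hk k hk, gromovProduct_le_left z (x k) (x k)]

variable [GeodesicSpace X₁] [GeodesicSpace X₂]

/-- Each pair of boundary points of the factors is represented by the coordinates of a sequence in
the product: lower the two representatives to their smaller height. -/
lemma exists_seq_of_convergesToInfinity {δ : ℝ} (hX₁ : FourPoint X₁ δ) (hX₂ : FourPoint X₂ δ)
    {o₁ : X₁} {o₂ : X₂} {x₁ : ℕ → X₁} {x₂ : ℕ → X₂} (h₁ : ConvergesToInfinity o₁ x₁)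
    (h₂ : ConvergesToInfinity o₂ x₂) : ∃ y : ℕ → HyperbolicProduct z₁ z₂,
      (∀ R, EventuallyProductGE o₁ x₁ (fst ∘ y) R) ∧
      ∀ R, EventuallyProductGE o₂ x₂ (snd ∘ y) R := by
  choose σ₁ hσ₁ using fun k => exists_isVertical z₁ (x₁ k)
  choose σ₂ hσ₂ using fun k => exists_isVertical z₂ (x₂ k)
  let h : ℕ → ℝ := fun k => min (dist (x₁ k) z₁) (dist (x₂ k) z₂)
  have hh₁ : ∀ k, h k ∈ Icc 0 (dist (x₁ k) z₁) := fun k =>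
    ⟨le_min dist_nonneg dist_nonneg, min_le_left _ _⟩
  have hh₂ : ∀ k, h k ∈ Icc 0 (dist (x₂ k) z₂) := fun k =>
    ⟨le_min dist_nonneg dist_nonneg, min_le_right _ _⟩
  have hlim : Tendsto h atTop atTop := by
    refine tendsto_atTop.2 fun R => ?_
    filter_upwards [(tendsto_dist_of_convergesToInfinity h₁ z₁).eventually_ge_atTop R,
      (tendsto_dist_of_convergesToInfinity h₂ z₂).eventually_ge_atTop R] with k hk hk'
    exact le_min hk hk'
  exact ⟨fun k => ofCoords (σ₁ k (h k)) (σ₂ k (h k)) (by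
      rw [(hσ₁ k).height _ (hh₁ k), (hσ₂ k).height _ (hh₂ k)]),
    eventuallyProductGE_vertical hX₁ h₁ hσ₁ hh₁ hlim,
    eventuallyProductGE_vertical hX₂ h₂ hσ₂ hh₂ hlim⟩

lemma exists_boundary_homeomorph {δ : ℝ} (hδ : 0 ≤ δ) (hX₁ : FourPoint X₁ δ)
    (hX₂ : FourPoint X₂ δ) (o : HyperbolicProduct z₁ z₂) (o₁ : X₁) (o₂ : X₂) :
    ∃ Φ : Boundary (HyperbolicProduct z₁ z₂) o ≃ₜ Boundary X₁ o₁ × Boundary X₂ o₂,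
      ∀ (y : ℕ → HyperbolicProduct z₁ z₂) (hy : ConvergesToInfinity o y),
        ∃ (h₁ : ConvergesToInfinity o₁ fun k => (y k).fst)
          (h₂ : ConvergesToInfinity o₂ fun k => (y k).snd),
          Φ (Boundary.mk o y hy) =
            (Boundary.mk o₁ (fun k => (y k).fst) h₁, Boundary.mk o₂ (fun k => (y k).snd) h₂) := by
  obtain ⟨C, hC⟩ := exists_abs_gromovProduct_sub_le hδ hX₁ hX₂ o o₁ o₂
  obtain ⟨δ', -, hY⟩ := exists_fourPointAt hδ hX₁ hX₂ o
  have hs : 0 < √(2 : ℝ) := Real.sqrt_pos.2 two_pos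
  have down : ∀ (R : ℝ) (x y : ℕ → HyperbolicProduct z₁ z₂),
      EventuallyProductGE o x y (√2 * R + C) →
      EventuallyProductGE o₁ (fst ∘ x) (fst ∘ y) R ∧
        EventuallyProductGE o₂ (snd ∘ x) (snd ∘ y) R := by
    rintro R x y ⟨N, hN⟩
    have hmin : ∀ k, N ≤ k → ∀ l, N ≤ l → R ≤ min (gromovProduct o₁ (x k).fst (y l).fst)
        (gromovProduct o₂ (x k).snd (y l).snd) := fun k hk l hl =>
      le_of_mul_le_mul_left (by linarith [hN k hk l hl, le_of_abs_le (hC (x k) (y l))]) hs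
    exact ⟨⟨N, fun k hk l hl => (hmin k hk l hl).trans (min_le_left _ _)⟩,
      ⟨N, fun k hk l hl => (hmin k hk l hl).trans (min_le_right _ _)⟩⟩
  have up : ∀ (R : ℝ) (x y : ℕ → HyperbolicProduct z₁ z₂),
      EventuallyProductGE o₁ (fst ∘ x) (fst ∘ y) R →
      EventuallyProductGE o₂ (snd ∘ x) (snd ∘ y) R →
      EventuallyProductGE o x y (√2 * R - C) := by
    rintro R x y ⟨N, hN⟩ ⟨N', hN'⟩
    refine ⟨max N N', fun k hk l hl => ?_⟩
    have h1 := le_min (hN k ((le_max_left _ _).trans hk) l ((le_max_left _ _).trans hl))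
      (hN' k ((le_max_right _ _).trans hk) l ((le_max_right _ _).trans hl))
    have h2 := mul_le_mul_of_nonneg_left h1 hs.le
    have h3 := neg_le_of_abs_le (hC (x k) (y l))
    simp only [Function.comp_apply] at h2
    linarith
  have upAll : ∀ x y : ℕ → HyperbolicProduct z₁ z₂,
      (∀ R, EventuallyProductGE o₁ (fst ∘ x) (fst ∘ y) R) →
      (∀ R, EventuallyProductGE o₂ (snd ∘ x) (snd ∘ y) R) →
      ∀ R, EventuallyProductGE o x y R := by
    intro x y h1 h2 R
    have := up ((R + C) / √2) x y (h1 _) (h2 _)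
    rwa [mul_div_cancel₀ _ hs.ne', add_sub_cancel_right] at this
  let Φ₁ : Boundary (HyperbolicProduct z₁ z₂) o → Boundary X₁ o₁ :=
    Boundary.map fst fun x y h R => (down R x y (h _)).1
  let Φ₂ : Boundary (HyperbolicProduct z₁ z₂) o → Boundary X₂ o₂ :=
    Boundary.map snd fun x y h R => (down R x y (h _)).2
  have hΦ₁ : Continuous Φ₁ := Boundary.continuous_map _ fun R => ⟨_, fun x y h => (down R x y h).1⟩
  have hΦ₂ : Continuous Φ₂ := Boundary.continuous_map _ fun R => ⟨_, fun x y h => (down R x y h).2⟩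
  have hinj : Function.Injective fun v => (Φ₁ v, Φ₂ v) := by
    intro v w h
    obtain ⟨x, hx, rfl⟩ := v.exists_rep
    obtain ⟨y, hy, rfl⟩ := w.exists_rep
    obtain ⟨h1, h2⟩ := Prod.mk.inj h
    exact (Boundary.mk_eq_mk_iff hY).2 (upAll x y ((Boundary.mk_eq_mk_iff (hX₁ o₁)).1 h1)
      ((Boundary.mk_eq_mk_iff (hX₂ o₂)).1 h2))
  have hsurj : Function.Surjective fun v => (Φ₁ v, Φ₂ v) := by
    rintro ⟨w₁, w₂⟩
    obtain ⟨x₁, hx₁, rfl⟩ := w₁.exists_rep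
    obtain ⟨x₂, hx₂, rfl⟩ := w₂.exists_rep
    obtain ⟨y, hy₁, hy₂⟩ := exists_seq_of_convergesToInfinity (z₁ := z₁) (z₂ := z₂) hX₁ hX₂ hx₁ hx₂
    have hy : ConvergesToInfinity o y := gromovLiminf_eq_top_iff.2 (upAll y y
      (eventuallyProductGE_all_trans (hX₁ o₁) (fun R => (hy₁ R).symm) hy₁)
      (eventuallyProductGE_all_trans (hX₂ o₂) (fun R => (hy₂ R).symm) hy₂))
    exact ⟨Boundary.mk o y hy, Prod.ext
      ((Boundary.mk_eq_mk_iff (hX₁ o₁)).2 fun R => (hy₁ R).symm)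
      ((Boundary.mk_eq_mk_iff (hX₂ o₂)).2 fun R => (hy₂ R).symm)⟩
  have hopen : IsOpenMap fun v => (Φ₁ v, Φ₂ v) := by
    intro S hS
    rw [isOpen_iff_mem_nhds]
    rintro _ ⟨v, hv, rfl⟩
    obtain ⟨r, -, hr⟩ := hS v hv
    set r' := (r + C) / √2 + 1 + 2 * δ with hr'
    refine mem_of_superset (prod_mem_nhds
      (Boundary.basicNhd_mem_nhds hδ (hX₁ o₁) (Φ₁ v) r')
      (Boundary.basicNhd_mem_nhds hδ (hX₂ o₂) (Φ₂ v) r')) ?_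
    rintro w ⟨hw₁, hw₂⟩
    obtain ⟨w, rfl⟩ := hsurj w
    refine ⟨w, hr ?_, rfl⟩
    obtain ⟨x, hx, rfl⟩ := v.exists_rep
    obtain ⟨y, hy, rfl⟩ := w.exists_rep
    have h1 := Boundary.eventuallyProductGE_of_mem_basicNhd (hX₁ o₁) hw₁
    have h2 := Boundary.eventuallyProductGE_of_mem_basicNhd (hX₂ o₂) hw₂
    have h3 := up _ x y h1 h2
    have e : √2 * (r' - 1 - 2 * δ) - C = r := by
      rw [hr']
      field_simp
      ring
    rw [e] at h3
    exact Boundary.mk_mem_basicNhd hx hy h3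
  refine ⟨(Equiv.ofBijective _ ⟨hinj, hsurj⟩).toHomeomorphOfContinuousOpen
    (hΦ₁.prodMk hΦ₂) hopen, fun y hy => ?_⟩
  have hy' := gromovLiminf_eq_top_iff.1 hy
  exact ⟨gromovLiminf_eq_top_iff.2 fun R => (down R y y (hy' _)).1,
    gromovLiminf_eq_top_iff.2 fun R => (down R y y (hy' _)).2, rfl⟩

end HyperbolicProduct

end HypProd

end

theorem theorem1 {X₁ X₂ : Type*} [MetricSpace X₁] [MetricSpace X₂]
    [ProperSpace X₁] [ProperSpace X₂] [HypProd.GeodesicSpace X₁] [HypProd.GeodesicSpace X₂]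
    (hX₁ : HypProd.IsHyperbolic X₁) (hX₂ : HypProd.IsHyperbolic X₂) (z₁ : X₁) (z₂ : X₂) :
    ProperSpace (HypProd.HyperbolicProduct z₁ z₂) ∧
    HypProd.GeodesicSpace (HypProd.HyperbolicProduct z₁ z₂) ∧
    HypProd.IsHyperbolic (HypProd.HyperbolicProduct z₁ z₂) ∧
    ∀ (o : HypProd.HyperbolicProduct z₁ z₂) (o₁ : X₁) (o₂ : X₂),
      ∃ Φ : HypProd.Boundary (HypProd.HyperbolicProduct z₁ z₂) o ≃ₜ
          HypProd.Boundary X₁ o₁ × HypProd.Boundary X₂ o₂,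
        ∀ (y : ℕ → HypProd.HyperbolicProduct z₁ z₂) (hy : HypProd.ConvergesToInfinity o y),
          ∃ (h₁ : HypProd.ConvergesToInfinity o₁ fun k => (y k).fst)
            (h₂ : HypProd.ConvergesToInfinity o₂ fun k => (y k).snd),
            Φ (HypProd.Boundary.mk o y hy) =
              (HypProd.Boundary.mk o₁ (fun k => (y k).fst) h₁,
                HypProd.Boundary.mk o₂ (fun k => (y k).snd) h₂) := by
  obtain ⟨δ₁, hδ₁, h₁⟩ := hX₁
  obtain ⟨δ₂, hδ₂, h₂⟩ := hX₂
  have h₁' := h₁.fourPoint.mono (le_max_left _ (3 * δ₂ + 1))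
  have h₂' := h₂.fourPoint.mono (le_max_right (3 * δ₁ + 1) _)
  exact ⟨HypProd.HyperbolicProduct.properSpace, HypProd.HyperbolicProduct.geodesicSpace,
    HypProd.HyperbolicProduct.isHyperbolic (le_max_of_le_left (by positivity)) h₁' h₂',
    HypProd.HyperbolicProduct.exists_boundary_homeomorph (le_max_of_le_left (by positivity))
      h₁' h₂'⟩
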